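/- Let $k$ be a number field and let $X$ and $Y$ be projective varieties over $k$, each given with an embedding in a projective space (smoothness and irreducibility are not needed); embed $X\times Y$ by the Segre map. For an archimedean place $v$ of $k$ (a pair of complex conjugate embeddings counts as one place, and $|\cdot|_v$ extends the usual absolute value of $\mathbb{Q}$) and $k$-rational points $a,b$ of a projective space put $$\mathrm{dist}_v(a,b)=\frac{\max_{i,j}|a_ib_j-a_jb_i|_v}{\max_i|a_i|_v\,\max_j|b_j|_v},\qquad \mathrm{dist}(a,b)=\sum_{v\mid\infty}\mathrm{dist}_v(a,b).$$ For a divisor class (line bundle) $L$ on a projective variety $V$ over $k$, let $H_L:V(k)\to\mathbb{R}_{>0}$ be an absolute multiplicative Weil height with respect to $L$; it is defined up to a factor bounded above and bounded away from $0$. Let $R\in V(k)$ be a point such that $H_L$ is bounded below by a positive constant on the rational points of some Zariski open neighbourhood of $R$. For a sequence $\{R_i\}\subset V(k)\setminus\{R\}$ with $\mathrm{dist}(R,R_i)\to 0$, its approximation constant (with respect to $R$ and $L$) is the smallest real number $a\ge 0$ with $$\limsup_{i\to\infty}\mathrm{dist}(R,R_i)^{a}H_L(R_i)<\infty,$$ if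 such a smallest number exists. The approximation constant of $R$ with respect to $L$ is the number $\alpha$, if it exists, such that some sequence as above has approximation constant $\alpha$, while no sequence as above satisfies the displayed condition with an exponent $0\le a<\alpha$. A sequence of best $L$-approximation to $R$ is a sequence whose approximation constant equals that of $R$. **Theorem.** Let $P\in X(k)$ and $Q\in Y(k)$, and let $L_X$ and $L_Y$ be divisor classes on $X$ and $Y$ whose height functions are bounded below by a positive constant on the rational points of some Zariski open neighbourhoods of $P$ and of $Q$, respectively. Let $\{P_i\}$ be a sequence of best $L_X$-approximation to $P$ with approximation constant $\alpha$, and let $\{Q_i\}$ be a sequence of best $L_Y$-approximation to $Q$ with approximation constant $\beta$. Put $L=\pi_1^*L_X\otimes\pi_2^*L_Y$ on $X\times Y$, where $\pi_1,\pi_2$ are the projections, and let $H_L$ be any height function for $L$. Then $H_L$ is bounded below by a positive constant on the rational points of some Zariski open neighbourhood of $(P,Q)$, and $\{(P_i,Q)\}$ or $\{(P,Q_i)\}$ is a sequence of best $L$-approximation to $(P,Q)$. Moreover, if a sequence $\{(S_i,T_i)\}\subset (X\times Y)(k)\setminus\{(P,Q)\}$ converging to $(P,Q)$ has an approximation constant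 with respect to $L$ which is less than $\alpha+\beta$, then for all but finitely many $i$ we have $S_i=P$ or $T_i=Q$. -/

import Mathlib

open MvPolynomial Filter Topology
open scoped LinearAlgebra.Projectivization

universe u

noncomputable section

/-- A projective variety over `k`, given with a closed embedding in a projective space: the type
`Pt` of its geometric points (the points over the algebraic closure of `k`), the projective space
with homogeneous coordinates indexed by the finite type `coord`, and an injection of `Pt` onto the
common zero set of some homogeneous polynomials with coefficients in `k`. It may be singular or
reducible. -/
structure ProjVariety (k : Type u) [Field k] where
  coord : Type
  [fintypeCoord : Fintype coord]
  Pt : Type u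
  emb : Pt → ℙ (AlgebraicClosure k) (coord → AlgebraicClosure k)
  emb_injective : Function.Injective emb
  closed : ∃ E : Set (MvPolynomial coord k), (∀ F ∈ E, ∃ d, F.IsHomogeneous d) ∧
    ∀ p, p ∈ Set.range emb ↔ ∀ F ∈ E, aeval p.rep F = 0

attribute [instance] ProjVariety.fintypeCoord

namespace ProjVariety

variable {k : Type u} [Field k]

/-! ### Zariski topology and regular functions -/

/-- The value of a polynomial at the chosen homogeneous coordinates of a geometric point. For
homogeneous `F`, `G` of the same degree, neither the condition `X.evalAt G x ≠ 0` nor the quotient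
`X.evalAt F x / X.evalAt G x` depends on the choice. -/
def evalAt (X : ProjVariety k) (F : MvPolynomial X.coord k) (x : X.Pt) : AlgebraicClosure k :=
  aeval (X.emb x).rep F

/-- Zariski open sets (over `k`) of geometric points: unions of basic open sets `{G ≠ 0}` with `G`
homogeneous over `k`. -/
def IsZariskiOpen (X : ProjVariety k) (U : Set X.Pt) : Prop :=
  ∀ x ∈ U, ∃ (d : ℕ) (G : MvPolynomial X.coord k), G.IsHomogeneous d ∧ X.evalAt G x ≠ 0 ∧
    ∀ y, X.evalAt G y ≠ 0 → y ∈ U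

/-- Functions that are regular on `U` and defined over `k`: locally quotients of two homogeneous
polynomials over `k` of the same degree. -/
def RegularOn (X : ProjVariety k) (U : Set X.Pt) (f : X.Pt → AlgebraicClosure k) : Prop :=
  ∀ x ∈ U, ∃ (d : ℕ) (F G : MvPolynomial X.coord k), F.IsHomogeneous d ∧ G.IsHomogeneous d ∧
    X.evalAt G x ≠ 0 ∧ ∀ y ∈ U, X.evalAt G y ≠ 0 → f y = X.evalAt F y / X.evalAt G y

theorem IsZariskiOpen.inter {X : ProjVariety k} {U V : Set X.Pt} (hU : X.IsZariskiOpen U)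
    (hV : X.IsZariskiOpen V) : X.IsZariskiOpen (U ∩ V) := by
  rintro x ⟨hxU, hxV⟩
  obtain ⟨d, G, hG, hx, h⟩ := hU x hxU
  obtain ⟨e, G', hG', hx', h'⟩ := hV x hxV
  refine ⟨d + e, G * G', hG.mul hG', ?_, fun y hy => ?_⟩
  · simpa [evalAt] using ⟨hx, hx'⟩
  · have : X.evalAt G y ≠ 0 ∧ X.evalAt G' y ≠ 0 := by simpa [evalAt] using hy
    exact ⟨h y this.1, h' y this.2⟩

theorem RegularOn.mono {X : ProjVariety k} {U V : Set X.Pt} {f : X.Pt → AlgebraicClosure k}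
    (hf : X.RegularOn V f) (h : U ⊆ V) : X.RegularOn U f := by
  intro x hx
  obtain ⟨d, F, G, hF, hG, hGx, hy⟩ := hf x (h hx)
  exact ⟨d, F, G, hF, hG, hGx, fun y hyU => hy y (h hyU)⟩

theorem RegularOn.mul {X : ProjVariety k} {U : Set X.Pt} {f g : X.Pt → AlgebraicClosure k}
    (hf : X.RegularOn U f) (hg : X.RegularOn U g) : X.RegularOn U (fun x => f x * g x) := by
  intro x hx
  obtain ⟨d, F, G, hF, hG, hGx, h⟩ := hf x hx
  obtain ⟨d', F', G', hF', hG', hGx', h'⟩ := hg x hx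
  refine ⟨d + d', F * F', G * G', hF.mul hF', hG.mul hG', ?_, fun y hyU hy => ?_⟩
  · simpa [evalAt] using ⟨hGx, hGx'⟩
  · have hy2 : X.evalAt G y ≠ 0 ∧ X.evalAt G' y ≠ 0 := by simpa [evalAt] using hy
    have h1 := h y hyU hy2.1
    have h2 := h' y hyU hy2.2
    simp only [evalAt, map_mul] at h1 h2 ⊢
    rw [h1, h2, div_mul_div_comm]

/-- A morphism of varieties over `k`: a continuous map on geometric points that pulls regular
functions back to regular functions. -/
structure Mor (X Y : ProjVariety k) where
  toFun : X.Pt → Y.Pt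
  isOpen_preimage : ∀ U, Y.IsZariskiOpen U → X.IsZariskiOpen (toFun ⁻¹' U)
  regularOn_comp : ∀ U f, Y.IsZariskiOpen U → Y.RegularOn U f →
    X.RegularOn (toFun ⁻¹' U) (fun x => f (toFun x))

/-! ### Products -/

theorem segre_ne_zero {K : Type*} [Field K] {σ τ : Type*} {a : σ → K} {b : τ → K} (ha : a ≠ 0)
    (hb : b ≠ 0) : (fun ij : σ × τ => a ij.1 * b ij.2) ≠ 0 := by
  obtain ⟨i, hi⟩ := Function.ne_iff.1 ha
  obtain ⟨j, hj⟩ := Function.ne_iff.1 hb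
  exact Function.ne_iff.2 ⟨(i, j), mul_ne_zero hi hj⟩

/-- The Segre map `([a], [b]) ↦ [a i * b j]`. -/
def segre {K : Type*} [Field K] {σ τ : Type*} (p : ℙ K (σ → K)) (q : ℙ K (τ → K)) :
    ℙ K (σ × τ → K) :=
  Projectivization.mk K (fun ij => p.rep ij.1 * q.rep ij.2)
    (segre_ne_zero p.rep_nonzero q.rep_nonzero)

theorem exists_segre_rep {K : Type*} [Field K] {σ τ : Type*} (p : ℙ K (σ → K))
    (q : ℙ K (τ → K)) :
    ∃ c : K, c ≠ 0 ∧ ∀ i j, (segre p q).rep (i, j) = c * (p.rep i * q.rep j) := by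
  obtain ⟨c, hc⟩ := Projectivization.exists_smul_eq_mk_rep K
    (fun ij : σ × τ => p.rep ij.1 * q.rep ij.2) (segre_ne_zero p.rep_nonzero q.rep_nonzero)
  refine ⟨c, c.ne_zero, fun i j => ?_⟩
  rw [segre, ← hc]
  simp [Units.smul_def]

theorem segre_mk {K : Type*} [Field K] {σ τ : Type*} {a : σ → K} {b : τ → K} (ha : a ≠ 0)
    (hb : b ≠ 0) : segre (Projectivization.mk K a ha) (Projectivization.mk K b hb) =
      Projectivization.mk K (fun ij => a ij.1 * b ij.2) (segre_ne_zero ha hb) := by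
  obtain ⟨c, hc⟩ := Projectivization.exists_smul_eq_mk_rep K a ha
  obtain ⟨d, hd⟩ := Projectivization.exists_smul_eq_mk_rep K b hb
  rw [segre, Projectivization.mk_eq_mk_iff]
  refine ⟨c * d, ?_⟩
  funext ij
  rw [← hc, ← hd]
  simp only [Units.smul_def, Pi.smul_apply, smul_eq_mul, Units.val_mul]
  ring

theorem aeval_smul_of_isHomogeneous {K : Type*} [Field K] [Algebra k K] {σ : Type*}
    {F : MvPolynomial σ k} {d : ℕ} (hF : F.IsHomogeneous d) (c : K) (a : σ → K) :
    aeval (fun i => c * a i) F = c ^ d * aeval a F := by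
  rw [aeval_def, aeval_def, eval₂_eq, eval₂_eq, Finset.mul_sum]
  refine Finset.sum_congr rfl fun m hm => ?_
  rw [hF.degree_eq_sum_deg_support hm]
  simp only [mul_pow, Finset.prod_mul_distrib, Finset.prod_pow_eq_pow_sum]
  ring

theorem aeval_segre_left {K : Type*} [Field K] [Algebra k K] {σ τ : Type*} {p : ℙ K (σ → K)}
    {q : ℙ K (τ → K)} {c : K} (hc : ∀ i j, (segre p q).rep (i, j) = c * (p.rep i * q.rep j))
    (j : τ) {F : MvPolynomial σ k} {d : ℕ} (hF : F.IsHomogeneous d) :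
    aeval (segre p q).rep (rename (fun i => (i, j)) F) = (c * q.rep j) ^ d * aeval p.rep F := by
  rw [aeval_rename, ← aeval_smul_of_isHomogeneous hF]
  congr 2
  funext i
  rw [Function.comp_apply, hc]
  ring

theorem aeval_segre_right {K : Type*} [Field K] [Algebra k K] {σ τ : Type*} {p : ℙ K (σ → K)}
    {q : ℙ K (τ → K)} {c : K} (hc : ∀ i j, (segre p q).rep (i, j) = c * (p.rep i * q.rep j))
    (i : σ) {F : MvPolynomial τ k} {d : ℕ} (hF : F.IsHomogeneous d) :
    aeval (segre p q).rep (rename (fun j => (i, j)) F) = (c * p.rep i) ^ d * aeval q.rep F := by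
  rw [aeval_rename, ← aeval_smul_of_isHomogeneous hF]
  congr 2
  funext j
  rw [Function.comp_apply, hc]
  ring

theorem aeval_mk_rep_eq_zero {K : Type*} [Field K] [Algebra k K] {σ : Type*} {a : σ → K}
    (ha : a ≠ 0) {F : MvPolynomial σ k} {d : ℕ} (hF : F.IsHomogeneous d) :
    aeval (Projectivization.mk K a ha).rep F = 0 ↔ aeval a F = 0 := by
  obtain ⟨c, hc⟩ := Projectivization.exists_smul_eq_mk_rep K a ha
  have : (Projectivization.mk K a ha).rep = fun i => (c : K) * a i := by
    rw [← hc]; rfl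
  rw [this, aeval_smul_of_isHomogeneous hF]
  simp

theorem segre_injective {K : Type*} [Field K] {σ τ : Type*} {p p' : ℙ K (σ → K)}
    {q q' : ℙ K (τ → K)} (h : segre p q = segre p' q') : p = p' ∧ q = q' := by
  obtain ⟨c, hc0, hc⟩ := exists_segre_rep p q
  obtain ⟨c', hc0', hc'⟩ := exists_segre_rep p' q'
  have key : ∀ i j, c * (p.rep i * q.rep j) = c' * (p'.rep i * q'.rep j) := fun i j => by
    rw [← hc, ← hc', h]
  obtain ⟨i₀, hi⟩ := Function.ne_iff.1 p.rep_nonzero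
  obtain ⟨j₀, hj⟩ := Function.ne_iff.1 q.rep_nonzero
  simp only [Pi.zero_apply] at hi hj
  constructor
  · rw [← p.mk_rep, ← p'.mk_rep, Projectivization.mk_eq_mk_iff']
    refine ⟨c' * q'.rep j₀ / (c * q.rep j₀), ?_⟩
    funext i
    have := key i j₀
    simp only [Pi.smul_apply, smul_eq_mul]
    field_simp
    linear_combination -this
  · rw [← q.mk_rep, ← q'.mk_rep, Projectivization.mk_eq_mk_iff']
    refine ⟨c' * p'.rep i₀ / (c * p.rep i₀), ?_⟩
    funext j
    have := key i₀ j
    simp only [Pi.smul_apply, smul_eq_mul]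
    field_simp
    linear_combination -this

/-- The product of two projective varieties, embedded by the Segre map. -/
def prod (X Y : ProjVariety k) : ProjVariety k where
  coord := X.coord × Y.coord
  Pt := X.Pt × Y.Pt
  emb z := segre (X.emb z.1) (Y.emb z.2)
  emb_injective := by
    rintro ⟨x, y⟩ ⟨x', y'⟩ h
    obtain ⟨h1, h2⟩ := segre_injective h
    exact Prod.ext (X.emb_injective h1) (Y.emb_injective h2)
  closed := by
    obtain ⟨E, hE, hX⟩ := X.closed
    obtain ⟨E', hE', hY⟩ := Y.closed
    refine ⟨{G | (∃ F ∈ E, ∃ j : Y.coord, G = rename (fun i => (i, j)) F) ∨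
      (∃ F ∈ E', ∃ i : X.coord, G = rename (fun j => (i, j)) F) ∨
      ∃ (i i' : X.coord) (j j' : Y.coord),
        G = MvPolynomial.X (i, j) * MvPolynomial.X (i', j') -
          MvPolynomial.X (i, j') * MvPolynomial.X (i', j)}, ?_, ?_⟩
    · rintro G (⟨F, hF, j, rfl⟩ | ⟨F, hF, i, rfl⟩ | ⟨i, i', j, j', rfl⟩)
      · obtain ⟨d, hd⟩ := hE F hF
        exact ⟨d, hd.rename_isHomogeneous⟩
      · obtain ⟨d, hd⟩ := hE' F hF
        exact ⟨d, hd.rename_isHomogeneous⟩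
      · exact ⟨1 + 1, ((isHomogeneous_X k _).mul (isHomogeneous_X k _)).sub
          ((isHomogeneous_X k _).mul (isHomogeneous_X k _))⟩
    · intro p
      constructor
      · rintro ⟨⟨x, y⟩, rfl⟩ G hG
        obtain ⟨c, -, hc⟩ := exists_segre_rep (X.emb x) (Y.emb y)
        rcases hG with ⟨F, hF, j, rfl⟩ | ⟨F, hF, i, rfl⟩ | ⟨i, i', j, j', rfl⟩
        · obtain ⟨d, hd⟩ := hE F hF
          rw [aeval_segre_left hc j hd, (hX _).1 ⟨x, rfl⟩ F hF, mul_zero]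
        · obtain ⟨d, hd⟩ := hE' F hF
          rw [aeval_segre_right hc i hd, (hY _).1 ⟨y, rfl⟩ F hF, mul_zero]
        · simp only [map_sub, map_mul, aeval_X, hc]
          ring
      · intro h
        obtain ⟨⟨i₀, j₀⟩, h0⟩ := Function.ne_iff.1 p.rep_nonzero
        simp only [Pi.zero_apply] at h0
        have ha : (fun i => p.rep (i, j₀)) ≠ 0 := Function.ne_iff.2 ⟨i₀, h0⟩
        have hb : (fun j => p.rep (i₀, j)) ≠ 0 := Function.ne_iff.2 ⟨j₀, h0⟩
        obtain ⟨x, hx⟩ := (hX (Projectivization.mk _ _ ha)).2 (fun F hF => by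
          obtain ⟨d, hd⟩ := hE F hF
          rw [aeval_mk_rep_eq_zero ha hd]
          simpa [aeval_rename, Function.comp_def] using h _ (Or.inl ⟨F, hF, j₀, rfl⟩))
        obtain ⟨y, hy⟩ := (hY (Projectivization.mk _ _ hb)).2 (fun F hF => by
          obtain ⟨d, hd⟩ := hE' F hF
          rw [aeval_mk_rep_eq_zero hb hd]
          simpa [aeval_rename, Function.comp_def] using h _ (Or.inr (Or.inl ⟨F, hF, i₀, rfl⟩)))
        refine ⟨(x, y), ?_⟩
        simp only [hx, hy]
        rw [segre_mk ha hb]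
        conv_rhs => rw [← p.mk_rep]
        rw [Projectivization.mk_eq_mk_iff']
        refine ⟨p.rep (i₀, j₀), ?_⟩
        funext ⟨i, j⟩
        have := h _ (Or.inr (Or.inr ⟨i₀, i, j₀, j, rfl⟩))
        simp only [map_sub, map_mul, aeval_X] at this
        simp only [Pi.smul_apply, smul_eq_mul]
        linear_combination this

/-- The first projection `X × Y → X`. -/
def fst (X Y : ProjVariety k) : Mor (X.prod Y) X where
  toFun z := z.1
  isOpen_preimage U hU := by
    rintro ⟨x, y⟩ hx
    obtain ⟨d, G, hG, hGx, h⟩ := hU x hx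
    obtain ⟨j, hj⟩ := Function.ne_iff.1 (Y.emb y).rep_nonzero
    refine ⟨d, rename (fun i => (i, j)) G, hG.rename_isHomogeneous, ?_, ?_⟩
    · obtain ⟨c, hc0, hc⟩ := exists_segre_rep (X.emb x) (Y.emb y)
      change aeval (segre (X.emb x) (Y.emb y)).rep _ ≠ 0
      rw [aeval_segre_left hc j hG]
      exact mul_ne_zero (pow_ne_zero _ (mul_ne_zero hc0 hj)) hGx
    · rintro ⟨x', y'⟩ h'
      obtain ⟨c, hc0, hc⟩ := exists_segre_rep (X.emb x') (Y.emb y')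
      change aeval (segre (X.emb x') (Y.emb y')).rep _ ≠ 0 at h'
      rw [aeval_segre_left hc j hG] at h'
      exact h x' (right_ne_zero_of_mul h')
  regularOn_comp U f _ hf := by
    rintro ⟨x, y⟩ hx
    obtain ⟨d, F, G, hF, hG, hGx, h⟩ := hf x hx
    obtain ⟨j, hj⟩ := Function.ne_iff.1 (Y.emb y).rep_nonzero
    refine ⟨d, rename (fun i => (i, j)) F, rename (fun i => (i, j)) G,
      hF.rename_isHomogeneous, hG.rename_isHomogeneous, ?_, ?_⟩
    · obtain ⟨c, hc0, hc⟩ := exists_segre_rep (X.emb x) (Y.emb y)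
      change aeval (segre (X.emb x) (Y.emb y)).rep _ ≠ 0
      rw [aeval_segre_left hc j hG]
      exact mul_ne_zero (pow_ne_zero _ (mul_ne_zero hc0 hj)) hGx
    · rintro ⟨x', y'⟩ hU' h'
      obtain ⟨c, hc0, hc⟩ := exists_segre_rep (X.emb x') (Y.emb y')
      change aeval (segre (X.emb x') (Y.emb y')).rep _ ≠ 0 at h'
      change f x' = aeval (segre (X.emb x') (Y.emb y')).rep _ /
        aeval (segre (X.emb x') (Y.emb y')).rep _
      rw [aeval_segre_left hc j hG] at h'
      rw [aeval_segre_left hc j hG, aeval_segre_left hc j hF,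
        mul_div_mul_left _ _ (left_ne_zero_of_mul h')]
      exact h x' hU' (right_ne_zero_of_mul h')

/-- The second projection `X × Y → Y`. -/
def snd (X Y : ProjVariety k) : Mor (X.prod Y) Y where
  toFun z := z.2
  isOpen_preimage U hU := by
    rintro ⟨x, y⟩ hy
    obtain ⟨d, G, hG, hGy, h⟩ := hU y hy
    obtain ⟨i, hi⟩ := Function.ne_iff.1 (X.emb x).rep_nonzero
    refine ⟨d, rename (fun j => (i, j)) G, hG.rename_isHomogeneous, ?_, ?_⟩
    · obtain ⟨c, hc0, hc⟩ := exists_segre_rep (X.emb x) (Y.emb y)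
      change aeval (segre (X.emb x) (Y.emb y)).rep _ ≠ 0
      rw [aeval_segre_right hc i hG]
      exact mul_ne_zero (pow_ne_zero _ (mul_ne_zero hc0 hi)) hGy
    · rintro ⟨x', y'⟩ h'
      obtain ⟨c, hc0, hc⟩ := exists_segre_rep (X.emb x') (Y.emb y')
      change aeval (segre (X.emb x') (Y.emb y')).rep _ ≠ 0 at h'
      rw [aeval_segre_right hc i hG] at h'
      exact h y' (right_ne_zero_of_mul h')
  regularOn_comp U f _ hf := by
    rintro ⟨x, y⟩ hy
    obtain ⟨d, F, G, hF, hG, hGy, h⟩ := hf y hy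
    obtain ⟨i, hi⟩ := Function.ne_iff.1 (X.emb x).rep_nonzero
    refine ⟨d, rename (fun j => (i, j)) F, rename (fun j => (i, j)) G,
      hF.rename_isHomogeneous, hG.rename_isHomogeneous, ?_, ?_⟩
    · obtain ⟨c, hc0, hc⟩ := exists_segre_rep (X.emb x) (Y.emb y)
      change aeval (segre (X.emb x) (Y.emb y)).rep _ ≠ 0
      rw [aeval_segre_right hc i hG]
      exact mul_ne_zero (pow_ne_zero _ (mul_ne_zero hc0 hi)) hGy
    · rintro ⟨x', y'⟩ hU' h'
      obtain ⟨c, hc0, hc⟩ := exists_segre_rep (X.emb x') (Y.emb y')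
      change aeval (segre (X.emb x') (Y.emb y')).rep _ ≠ 0 at h'
      change f y' = aeval (segre (X.emb x') (Y.emb y')).rep _ /
        aeval (segre (X.emb x') (Y.emb y')).rep _
      rw [aeval_segre_right hc i hG] at h'
      rw [aeval_segre_right hc i hG, aeval_segre_right hc i hF,
        mul_div_mul_left _ _ (left_ne_zero_of_mul h')]
      exact h y' hU' (right_ne_zero_of_mul h')

/-! ### Line bundles -/

/-- A line bundle over `k` on `X` (an invertible sheaf, the class of a Cartier divisor), given by
a trivializing Zariski open cover `U i` and transition functions `g i j`, regular and nowhere zero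
on `U i ∩ U j`. -/
structure LineBundle (X : ProjVariety k) where
  I : Type u
  U : I → Set X.Pt
  isOpen : ∀ i, X.IsZariskiOpen (U i)
  cover : ∀ x, ∃ i, x ∈ U i
  g : I → I → X.Pt → AlgebraicClosure k
  regular : ∀ i j, X.RegularOn (U i ∩ U j) (g i j)
  ne_zero : ∀ i j, ∀ x ∈ U i ∩ U j, g i j x ≠ 0
  cocycle : ∀ i j l, ∀ x ∈ U i ∩ U j ∩ U l, g i j x * g j l x = g i l x

namespace LineBundle

/-- The tensor product `L ⊗ M`. -/
def tensor {X : ProjVariety k} (L M : X.LineBundle) : X.LineBundle where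
  I := L.I × M.I
  U i := L.U i.1 ∩ M.U i.2
  isOpen i := (L.isOpen i.1).inter (M.isOpen i.2)
  cover x := by
    obtain ⟨i, hi⟩ := L.cover x
    obtain ⟨j, hj⟩ := M.cover x
    exact ⟨(i, j), hi, hj⟩
  g i j x := L.g i.1 j.1 x * M.g i.2 j.2 x
  regular i j := ((L.regular i.1 j.1).mono fun _ h => ⟨h.1.1, h.2.1⟩).mul
    ((M.regular i.2 j.2).mono fun _ h => ⟨h.1.2, h.2.2⟩)
  ne_zero i j _ h := mul_ne_zero (L.ne_zero _ _ _ ⟨h.1.1, h.2.1⟩) (M.ne_zero _ _ _ ⟨h.1.2, h.2.2⟩)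
  cocycle i j l x h := by
    rw [← L.cocycle i.1 j.1 l.1 x ⟨⟨h.1.1.1, h.1.2.1⟩, h.2.1⟩,
      ← M.cocycle i.2 j.2 l.2 x ⟨⟨h.1.1.2, h.1.2.2⟩, h.2.2⟩]
    ring

/-- The pullback `f^* L` along a morphism `f`. -/
def pullback {X Y : ProjVariety k} (f : Mor X Y) (L : Y.LineBundle) : X.LineBundle where
  I := L.I
  U i := f.toFun ⁻¹' L.U i
  isOpen i := f.isOpen_preimage _ (L.isOpen i)
  cover x := L.cover (f.toFun x)
  g i j x := L.g i j (f.toFun x)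
  regular i j := f.regularOn_comp _ _ ((L.isOpen i).inter (L.isOpen j)) (L.regular i j)
  ne_zero i j _ h := L.ne_zero i j _ h
  cocycle i j l _ h := L.cocycle i j l _ h

/-- A finite family of global sections of `L`, defined over `k`, without common zero (so that it
defines a morphism `φ` from `X` to a projective space with `φ^* O(1) ≅ L`). The function `s l i`
is the `l`-th section in the trivialization over `U i`. -/
structure GeneratingSections {X : ProjVariety k} (L : X.LineBundle) where
  ι : Type
  [fintypeι : Fintype ι]
  s : ι → L.I → X.Pt → AlgebraicClosure k
  regular : ∀ l i, X.RegularOn (L.U i) (s l i)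
  compat : ∀ l i j, ∀ x ∈ L.U i ∩ L.U j, s l i x = L.g i j x * s l j x
  exists_ne_zero : ∀ i, ∀ x ∈ L.U i, ∃ l, s l i x ≠ 0

attribute [instance] GeneratingSections.fintypeι

end LineBundle

/-! ### Rational points -/

/-- A geometric point is `k`-rational if it has homogeneous coordinates in `k`. -/
def IsRational (X : ProjVariety k) (x : X.Pt) : Prop :=
  ∃ (a : X.coord → k) (h : (fun i => algebraMap k (AlgebraicClosure k) (a i)) ≠ 0),
    X.emb x = Projectivization.mk _ _ h

/-- The set `X(k)` of `k`-rational points. -/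
abbrev RatPt (X : ProjVariety k) : Type u := {x : X.Pt // X.IsRational x}

/-- Homogeneous coordinates in `k` of a `k`-rational point. -/
def RatPt.coords {X : ProjVariety k} (x : X.RatPt) : X.coord → k := x.2.choose

/-- The point `(x, y)` of `(X × Y)(k) = X(k) × Y(k)`. -/
def RatPt.pair {X Y : ProjVariety k} (x : X.RatPt) (y : Y.RatPt) : (X.prod Y).RatPt :=
  ⟨(x.1, y.1), by
    obtain ⟨x, a, ha, hx⟩ := x
    obtain ⟨y, b, hb, hy⟩ := y
    have h : (fun ij : X.coord × Y.coord =>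
        algebraMap k (AlgebraicClosure k) (a ij.1 * b ij.2)) ≠ 0 := by
      simpa only [map_mul] using segre_ne_zero ha hb
    refine ⟨fun ij => a ij.1 * b ij.2, h, ?_⟩
    change segre (X.emb x) (Y.emb y) = _
    rw [hx, hy, segre_mk ha hb]
    congr 1
    funext ij
    simp⟩

/-! ### Heights and distances -/

variable [NumberField k]

/-- The absolute multiplicative height on `X(k)` defined by a generating family of sections of a
line bundle: the height of the point with homogeneous coordinates the values of the sections, read
in any trivialization. At a `k`-rational point these values lie in `k`. -/
def LineBundle.GeneratingSections.height {X : ProjVariety k} {L : X.LineBundle}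
    (S : L.GeneratingSections) (x : X.RatPt) : ℝ :=
  Height.mulHeight (fun l => Function.invFun (algebraMap k (AlgebraicClosure k))
    (S.s l (L.cover x.1).choose x.1)) ^ ((Module.finrank ℚ k : ℝ)⁻¹)

/-- `H` is a (Weil) height function on `X(k)` for `L`: up to a factor bounded above and bounded
away from zero it is a quotient of the heights defined by generating sections of `L ⊗ B` and
of `B`, for some line bundle `B`. (Every line bundle on a projective variety has height functions,
and any two of them agree up to such a factor.) -/
def IsWeilHeight {X : ProjVariety k} (L : X.LineBundle) (H : X.RatPt → ℝ) : Prop :=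
  ∃ (B : X.LineBundle) (t : B.GeneratingSections) (s : (L.tensor B).GeneratingSections) (C : ℝ),
    0 < C ∧ ∀ x, C⁻¹ * (s.height x / t.height x) ≤ H x ∧ H x ≤ C * (s.height x / t.height x)

/-- `H` is bounded below by a positive constant on the rational points of some Zariski open
neighbourhood of `P`. -/
def BoundedBelowNear {X : ProjVariety k} (H : X.RatPt → ℝ) (P : X.RatPt) : Prop :=
  ∃ U, X.IsZariskiOpen U ∧ P.1 ∈ U ∧ ∃ c : ℝ, 0 < c ∧ ∀ x : X.RatPt, x.1 ∈ U → c < H x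

/-- The `v`-adic distance of two points `[a]`, `[b]` of projective space, `v` archimedean:
`max |a i * b j - a j * b i| / (max |a i| * max |b j|)`. -/
def distAt {X : ProjVariety k} (v : NumberField.InfinitePlace k) (x y : X.RatPt) : ℝ :=
  (⨆ ij : X.coord × X.coord,
      v (x.coords ij.1 * y.coords ij.2 - x.coords ij.2 * y.coords ij.1)) /
    ((⨆ i, v (x.coords i)) * ⨆ j, v (y.coords j))

/-- The sum of the distances over all archimedean places of `k`, where a pair of complex
conjugate embeddings counts as one place. -/
def dist {X : ProjVariety k} (x y : X.RatPt) : ℝ := ∑ v, distAt v x y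

/-! ### Approximation constants -/

/-- `S` is a sequence in `X(k) - {P}` that converges to `P`. -/
def Approximates {X : ProjVariety k} (S : ℕ → X.RatPt) (P : X.RatPt) : Prop :=
  (∀ i, S i ≠ P) ∧ Tendsto (fun i => dist P (S i)) atTop (𝓝 0)

/-- The condition `limsup dist(P, S i) ^ a * H (S i) < ∞`. -/
def FiniteLimsup {X : ProjVariety k} (H : X.RatPt → ℝ) (P : X.RatPt) (S : ℕ → X.RatPt)
    (a : ℝ) : Prop :=
  IsBoundedUnder (· ≤ ·) atTop fun i => dist P (S i) ^ a * H (S i)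

/-- `α` is the approximation constant of the sequence `S` with respect to `P` and `H`: the
smallest real `a ≥ 0` with `limsup dist(P, S i) ^ a * H (S i) < ∞`. -/
def IsSeqConst {X : ProjVariety k} (H : X.RatPt → ℝ) (P : X.RatPt) (S : ℕ → X.RatPt)
    (α : ℝ) : Prop :=
  Approximates S P ∧ IsLeast {a : ℝ | 0 ≤ a ∧ FiniteLimsup H P S a} α

/-- `α` is the approximation constant of the point `P` with respect to `H`: it is the
approximation constant of some sequence, and no sequence in `X(k) - {P}` that converges to `P`
satisfies the limsup condition with a smaller exponent. -/
def IsPointConst {X : ProjVariety k} (H : X.RatPt → ℝ) (P : X.RatPt) (α : ℝ) : Prop :=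
  (∃ S, IsSeqConst H P S α) ∧
    ∀ S, Approximates S P → ∀ a : ℝ, 0 ≤ a → FiniteLimsup H P S a → α ≤ a

/-- `S` is a sequence of best approximation to `P`: its approximation constant is that of `P`. -/
def IsBestSeq {X : ProjVariety k} (H : X.RatPt → ℝ) (P : X.RatPt) (S : ℕ → X.RatPt) : Prop :=
  ∃ α, IsPointConst H P α ∧ IsSeqConst H P S α

end ProjVariety

end

/-! Up to bounded factors everything on `X × Y` splits into contributions of the two factors. The
Segre distance is at most the sum of the two distances and at least a quarter of each
(`dist_pair_le`, `dist_left_le`, `dist_right_le`). The product `HX * HY` is a Weil height for `L`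
(`IsWeilHeight.prod`), and two Weil heights of one line bundle are comparable
(`IsWeilHeight.exists_le`).

Comparability of heights is the geometric input. For two generating families of one bundle, the
Nullstellensatz writes the second, on each chart `x_j = 1`, as a polynomial matrix times the first.
Clearing denominators with a power `N` turns this into a linear map between tensor products with
degree `N` monomials in the coordinates `a`; both heights acquire the same factor `mulHeight a ^ N`,
which cancels.

A Zariski neighbourhood contains a small ball for `dist` (`IsZariskiOpen.exists_dist_lt`), so each
height is bounded below along every sequence converging to its point. If a sequence tends to `(P,
Q)`, one component, say the first, avoids its limit infinitely often. The height of the other is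
bounded below, so an admissible exponent for the sequence is admissible for a subsequence of first
components, and is at least `α`. Thus no exponent is below `min α β`, and `(P_i, Q)` or `(P, Q_i)`
attains this value.

Suppose both components avoid their limits infinitely often and `γ < α + β`. Write `γ = θα + θβ`
with `θ < 1`. By minimality of `α`, `dist ^ (θα) * HX` tends to infinity along the first components
if `α > 0`, and it is bounded below if `α = 0`; likewise for `β`. As `α + β > 0`, the product is
unbounded, so `γ` is not admissible. -/

/-! ### Heights of tuples related by polynomial matrices -/

section PolynomialMatrix

variable {K : Type*} [Field K] {σ : Type*}

/-- The space of functions on `σ → K` spanned by the monomials of degree `N`. -/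
def monomialSpan (K : Type*) [Field K] (σ : Type*) (N : ℕ) : Submodule K ((σ → K) → K) :=
  Submodule.span K (Set.range fun (f : Fin N → σ) (a : σ → K) => ∏ t, a (f t))

theorem mul_mem_monomialSpan {N : ℕ} {g : (σ → K) → K} (hg : g ∈ monomialSpan K σ N) (i : σ) :
    (fun a => a i * g a) ∈ monomialSpan K σ (N + 1) := by
  induction hg using Submodule.span_induction with
  | mem g h =>
    obtain ⟨f, rfl⟩ := h
    refine Submodule.subset_span ⟨Fin.cons i f, ?_⟩
    funext a
    simp [Fin.prod_univ_succ]
  | zero =>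
    convert! Submodule.zero_mem (monomialSpan K σ (N + 1)) using 1
    funext a
    simp
  | add x y _ _ hx hy =>
    convert! Submodule.add_mem _ hx hy using 1
    funext a
    simp [mul_add]
  | smul c x _ hx =>
    convert! Submodule.smul_mem _ c hx using 1
    funext a
    simp [mul_left_comm]

theorem pow_mem_monomialSpan (N : ℕ) (j : σ) : (fun a => a j ^ N) ∈ monomialSpan K σ N :=
  Submodule.subset_span ⟨fun _ => j, by simp⟩

/-- A large power of `a j` clears the denominators of the dehomogenized polynomial. Positivity of
`N₀` matters where `a j = 0`: division by zero gives `0` there, and the power of `a j` makes both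
sides vanish. -/
theorem exists_dehomogenized_mem_monomialSpan (j : σ) (p : MvPolynomial σ K) :
    ∃ N₀, 0 < N₀ ∧ ∀ N, N₀ ≤ N →
      (fun a => a j ^ N * eval (fun i => a i / a j) p) ∈ monomialSpan K σ N := by
  induction p using MvPolynomial.induction_on with
  | C c =>
    refine ⟨1, one_pos, fun N _ => ?_⟩
    convert! Submodule.smul_mem _ c (pow_mem_monomialSpan N j) using 1
    funext a
    simp [mul_comm]
  | add p q hp hq =>
    obtain ⟨n, hn, hp⟩ := hp
    obtain ⟨m, -, hq⟩ := hq
    refine ⟨max n m, by omega, fun N hN => ?_⟩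
    convert! Submodule.add_mem _ (hp N (by omega)) (hq N (by omega)) using 1
    funext a
    simp [mul_add]
  | mul_X p i hp =>
    obtain ⟨n, hn, hp⟩ := hp
    refine ⟨n + 1, by omega, fun N hN => ?_⟩
    obtain ⟨M, rfl⟩ : ∃ M, N = M + 1 := ⟨N - 1, by omega⟩
    convert! mul_mem_monomialSpan (hp M (by omega)) i using 1
    funext a
    rcases eq_or_ne (a j) 0 with h | h
    · simp [h, show M ≠ 0 by omega]
    · simp only [map_mul, eval_X]
      field_simp
      ring

open Height in
/-- If `w' = P w` for a matrix `P` of polynomials in the affine coordinates `a i / a j`, for all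
`j` with `a j ≠ 0`, then the height of `w'` is bounded in terms of that of `w`. -/
theorem exists_mulHeight_le_of_polynomial_matrix [Fintype σ] [AdmissibleAbsValues K] {ι ι' : Type*}
    [Fintype ι] [Finite ι'] (P : σ → ι' → ι → MvPolynomial σ K) :
    ∃ C : ℝ, 0 < C ∧ ∀ (a : σ → K) (w : ι → K) (w' : ι' → K), a ≠ 0 → w ≠ 0 → w' ≠ 0 →
      (∀ j, a j ≠ 0 → ∀ l, w' l = ∑ m, eval (fun i => a i / a j) (P j l m) * w m) →
      mulHeight w' ≤ C * mulHeight w := by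
  classical
  have := Fintype.ofFinite ι'
  choose N₀ hN₀ hmem using fun z : σ × ι' × ι =>
    exists_dehomogenized_mem_monomialSpan z.1 (P z.1 z.2.1 z.2.2)
  -- One exponent that serves all matrix entries; the `+ 1` keeps it positive even when there are
  -- none.
  set N := ∑ z, N₀ z + 1
  have hN : ∀ z, N₀ z ≤ N := fun z =>
    (Finset.single_le_sum (fun _ _ => Nat.zero_le _) (Finset.mem_univ z)).trans (Nat.le_succ _)
  choose c hc using fun z => (Submodule.mem_span_range_iff_exists_fun K).1 (hmem z N (hN z))
  let A : (σ × ι') × ((Fin N → σ) × ι) → K := fun z => c (z.1.1, z.1.2, z.2.2) z.2.1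
  -- The final `+ 1` keeps the constant positive when the index type is empty.
  refine ⟨Nat.card ((Fin N → σ) × ι) ^ totalWeight K * mulHeight A + 1,
    by have := mulHeight_pos A; positivity, fun a w w' ha hw hw' h => ?_⟩
  obtain ⟨i₀, -⟩ := Function.ne_iff.1 ha
  obtain ⟨m₀, -⟩ := Function.ne_iff.1 hw
  have : Nonempty ((Fin N → σ) × ι) := ⟨(fun _ => i₀, m₀)⟩
  have key := mulHeight_linearMap_apply_le A
    (fun z : (Fin N → σ) × ι => (∏ t, a (z.1 t)) * w z.2)
  have hmon : (fun f : Fin N → σ => ∏ t, a (f t)) ≠ 0 := by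
    obtain ⟨i, hi⟩ := Function.ne_iff.1 ha
    exact Function.ne_iff.2 ⟨fun _ => i, by simpa using hi⟩
  have hpow : a ^ N ≠ 0 := pow_ne_zero N ha
  have hl : (fun z : σ × ι' => ∑ y : (Fin N → σ) × ι, A (z, y) * ((∏ t, a (y.1 t)) * w y.2)) =
      fun z => (a ^ N) z.1 * w' z.2 := by
    funext ⟨j, l⟩
    rw [Fintype.sum_prod_type_right]
    have (m : ι) : ∑ f, A ((j, l), f, m) * ((∏ t, a (f t)) * w m) =
        a j ^ N * eval (fun i => a i / a j) (P j l m) * w m := by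
      have := congrFun (hc (j, l, m)) a
      simp only [Finset.sum_apply, Pi.smul_apply, smul_eq_mul] at this
      rw [← this, Finset.sum_mul]
      exact Finset.sum_congr rfl fun f _ => by simp only [A]; ring
    simp only [this, Pi.pow_apply]
    rcases eq_or_ne (a j) 0 with h0 | h0
    · simp [h0, N]
    · rw [h j h0 l, Finset.mul_sum]
      exact Finset.sum_congr rfl fun m _ => by ring
  -- Heights are multiplicative on tensor products, so both sides of `key` contain `mulHeight a ^
  -- N`.
  rw [hl, mulHeight_fun_mul_eq hpow hw', mulHeight_fun_mul_eq hmon hw,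
    mulHeight_fun_prod_eq (x := fun _ : Fin N => a) (fun _ => ha), mulHeight_pow,
    Finset.prod_const, Finset.card_univ, Fintype.card_fin] at key
  have hpos : 0 < mulHeight a ^ N := pow_pos (mulHeight_pos a) N
  have hw0 := mulHeight_pos w
  refine le_of_mul_le_mul_left ?_ hpos
  nlinarith [mul_pos hpos hw0]

end PolynomialMatrix

noncomputable section

namespace ProjVariety

variable {k : Type u} [Field k]

/-! ### Coordinates and values at rational points -/

section Coordinates

variable {X : ProjVariety k}

theorem exists_rep_eq_smul {x : X.Pt} {a : X.coord → AlgebraicClosure k} {ha : a ≠ 0}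
    (h : X.emb x = Projectivization.mk _ a ha) :
    ∃ c : AlgebraicClosure k, c ≠ 0 ∧ (X.emb x).rep = fun i => c * a i := by
  obtain ⟨c, hc⟩ := Projectivization.exists_smul_eq_mk_rep (AlgebraicClosure k) a ha
  exact ⟨c, c.ne_zero, by rw [h, ← hc]; rfl⟩

theorem exists_evalAt_eq {x : X.Pt} {a : X.coord → AlgebraicClosure k} {ha : a ≠ 0}
    (h : X.emb x = Projectivization.mk _ a ha) :
    ∃ c : AlgebraicClosure k, c ≠ 0 ∧ ∀ (d : ℕ) (F : MvPolynomial X.coord k),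
      F.IsHomogeneous d → X.evalAt F x = c ^ d * aeval a F := by
  obtain ⟨c, hc, hrep⟩ := exists_rep_eq_smul h
  exact ⟨c, hc, fun d F hF => by rw [evalAt, hrep, aeval_smul_of_isHomogeneous hF]⟩

namespace RatPt

theorem coords_ne_zero_map (x : X.RatPt) :
    (fun i => algebraMap k (AlgebraicClosure k) (x.coords i)) ≠ 0 :=
  x.2.choose_spec.choose

theorem emb_eq (x : X.RatPt) :
    X.emb x.1 = Projectivization.mk _ _ x.coords_ne_zero_map :=
  x.2.choose_spec.choose_spec

theorem coords_ne_zero (x : X.RatPt) : x.coords ≠ 0 := by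
  intro h
  exact x.coords_ne_zero_map (by funext i; simp [h])

theorem exists_evalAt_eq (x : X.RatPt) :
    ∃ c : AlgebraicClosure k, c ≠ 0 ∧ ∀ (d : ℕ) (F : MvPolynomial X.coord k),
      F.IsHomogeneous d →
        X.evalAt F x.1 = c ^ d * algebraMap k (AlgebraicClosure k) (eval x.coords F) := by
  obtain ⟨c, hc, h⟩ := ProjVariety.exists_evalAt_eq x.emb_eq
  refine ⟨c, hc, fun d F hF => ?_⟩
  rw [h d F hF]
  congr 1
  rw [← coe_aeval_eq_eval]
  exact aeval_algebraMap_apply (AlgebraicClosure k) x.coords F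

end RatPt

/-- Numerator and denominator have the same degree, so the scalar relating the chosen representative
to coordinates in `k` cancels. -/
theorem RegularOn.exists_algebraMap_eq {U : Set X.Pt} {f : X.Pt → AlgebraicClosure k}
    (hf : X.RegularOn U f) (x : X.RatPt) (hx : x.1 ∈ U) :
    ∃ z : k, algebraMap k (AlgebraicClosure k) z = f x.1 := by
  obtain ⟨d, F, G, hF, hG, hGx, h⟩ := hf x.1 hx
  obtain ⟨c, hc, he⟩ := x.exists_evalAt_eq
  refine ⟨eval x.coords F / eval x.coords G, ?_⟩
  rw [h x.1 hx hGx, he d F hF, he d G hG, mul_div_mul_left _ _ (pow_ne_zero _ hc), map_div₀]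

end Coordinates

/-! ### Operations on generating families of sections -/

namespace LineBundle

variable {X Y : ProjVariety k}

namespace GeneratingSections

/-- The products of the sections of two generating families generate the tensor product. -/
def tensor {L M : X.LineBundle} (S : L.GeneratingSections) (T : M.GeneratingSections) :
    (L.tensor M).GeneratingSections where
  ι := S.ι × T.ι
  s l i x := S.s l.1 i.1 x * T.s l.2 i.2 x
  regular l i := ((S.regular l.1 i.1).mono fun _ h => h.1).mul
    ((T.regular l.2 i.2).mono fun _ h => h.2)
  compat l i j x h := by
    change _ = (L.g i.1 j.1 x * M.g i.2 j.2 x) * _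
    rw [S.compat l.1 i.1 j.1 x ⟨h.1.1, h.2.1⟩, T.compat l.2 i.2 j.2 x ⟨h.1.2, h.2.2⟩]
    ring
  exists_ne_zero i x h := by
    obtain ⟨l, hl⟩ := S.exists_ne_zero i.1 x h.1
    obtain ⟨m, hm⟩ := T.exists_ne_zero i.2 x h.2
    exact ⟨(l, m), mul_ne_zero hl hm⟩

/-- The pullback of a generating family of sections. -/
def pullback (f : Mor X Y) {L : Y.LineBundle} (S : L.GeneratingSections) :
    (L.pullback f).GeneratingSections where
  ι := S.ι
  s l i x := S.s l i (f.toFun x)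
  regular l i := f.regularOn_comp _ _ (L.isOpen i) (S.regular l i)
  compat l i j _ h := S.compat l i j _ h
  exists_ne_zero i _ h := S.exists_ne_zero i _ h

/-- Transport of sections to a bundle with the same cocycle on a differently indexed cover. -/
def reindex {L M : X.LineBundle} (S : L.GeneratingSections) (e : M.I → L.I)
    (hU : ∀ i, M.U i ⊆ L.U (e i))
    (hg : ∀ i j, ∀ x ∈ M.U i ∩ M.U j, M.g i j x = L.g (e i) (e j) x) :
    M.GeneratingSections where
  ι := S.ι
  s l i x := S.s l (e i) x
  regular l i := (S.regular l (e i)).mono (hU i)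
  compat l i j x h := by
    rw [hg i j x h, S.compat l (e i) (e j) x ⟨hU i h.1, hU j h.2⟩]
  exists_ne_zero i x h := S.exists_ne_zero (e i) x (hU i h)

theorem exists_values {L : X.LineBundle} (S : L.GeneratingSections) (x : X.RatPt) {i : L.I}
    (hi : x.1 ∈ L.U i) : ∃ w : S.ι → k, w ≠ 0 ∧
      ∀ l, algebraMap k (AlgebraicClosure k) (w l) = S.s l i x.1 := by
  choose w hw using fun l => (S.regular l i).exists_algebraMap_eq x hi
  refine ⟨w, fun h => ?_, hw⟩
  obtain ⟨l, hl⟩ := S.exists_ne_zero i x.1 hi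
  exact hl (by rw [← hw, h]; simp)

end GeneratingSections

end LineBundle

/-! ### Heights defined by generating families of sections -/

variable [NumberField k]

namespace LineBundle.GeneratingSections

variable {X Y : ProjVariety k}

/-- Changing the trivialization multiplies all section values by one nonzero transition value in
`k`, and the height of a tuple is invariant under scaling. -/
theorem height_eq {L : X.LineBundle} (S : L.GeneratingSections) (x : X.RatPt) {i : L.I}
    (hi : x.1 ∈ L.U i) {w : S.ι → k}
    (hw : ∀ l, algebraMap k (AlgebraicClosure k) (w l) = S.s l i x.1) :
    S.height x = Height.mulHeight w ^ ((Module.finrank ℚ k : ℝ)⁻¹) := by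
  have hj := (L.cover x.1).choose_spec
  set j := (L.cover x.1).choose
  obtain ⟨c, hc⟩ := (L.regular j i).exists_algebraMap_eq x ⟨hj, hi⟩
  have hc0 : c ≠ 0 := by
    rintro rfl
    exact L.ne_zero j i x.1 ⟨hj, hi⟩ (by rw [← hc]; simp)
  rw [height, ← Height.mulHeight_smul_eq_mulHeight w hc0]
  congr 2
  funext l
  change Function.invFun (algebraMap k (AlgebraicClosure k)) (S.s l j x.1) = _
  rw [S.compat l j i x.1 ⟨hj, hi⟩, ← hc, ← hw, ← map_mul]
  exact Function.leftInverse_invFun (algebraMap k (AlgebraicClosure k)).injective _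

theorem height_pos {L : X.LineBundle} (S : L.GeneratingSections) (x : X.RatPt) :
    0 < S.height x :=
  Real.rpow_pos_of_pos (Height.mulHeight_pos _) _

theorem height_tensor {L M : X.LineBundle} (S : L.GeneratingSections)
    (T : M.GeneratingSections) (x : X.RatPt) :
    (S.tensor T).height x = S.height x * T.height x := by
  obtain ⟨i, hi⟩ := L.cover x.1
  obtain ⟨j, hj⟩ := M.cover x.1
  obtain ⟨w, hw0, hw⟩ := S.exists_values x hi
  obtain ⟨z, hz0, hz⟩ := T.exists_values x hj
  rw [S.height_eq x hi hw, T.height_eq x hj hz,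
    (S.tensor T).height_eq x (i := (i, j)) ⟨hi, hj⟩ (w := fun l => w l.1 * z l.2)
      (fun l => by rw [map_mul, hw, hz]; rfl),
    ← Real.mul_rpow (Height.mulHeight_pos _).le (Height.mulHeight_pos _).le,
    ← Height.mulHeight_fun_mul_eq hw0 hz0]
  rfl

theorem height_pullback (f : Mor X Y) {L : Y.LineBundle} (S : L.GeneratingSections)
    {x : X.RatPt} {y : Y.RatPt} (h : f.toFun x.1 = y.1) :
    (S.pullback f).height x = S.height y := by
  obtain ⟨i, hi⟩ := L.cover y.1
  obtain ⟨w, hw0, hw⟩ := S.exists_values y hi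
  rw [S.height_eq y hi hw, (S.pullback f).height_eq x (i := i) (w := w)
    (by rw [← h] at hi; exact hi) (fun l => (hw l).trans (by rw [← h]; rfl))]
  rfl

theorem height_reindex {L M : X.LineBundle} (S : L.GeneratingSections) (e : M.I → L.I)
    (hU : ∀ i, M.U i ⊆ L.U (e i))
    (hg : ∀ i j, ∀ x ∈ M.U i ∩ M.U j, M.g i j x = L.g (e i) (e j) x) (x : X.RatPt) :
    (S.reindex e hU hg).height x = S.height x := by
  obtain ⟨i, hi⟩ := M.cover x.1
  obtain ⟨w, hw0, hw⟩ := S.exists_values x (hU i hi)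
  rw [S.height_eq x (hU i hi) hw, (S.reindex e hU hg).height_eq x hi (w := w) hw]
  rfl

end LineBundle.GeneratingSections

end ProjVariety

end

noncomputable section

namespace ProjVariety

variable {k : Type u} [Field k] {X Y : ProjVariety k}

/-! ### Rational points of products -/

/-- A column of the matrix of Segre coordinates that contains a nonzero entry is proportional to the
coordinates of the first component. -/
theorem IsRational.fst {z : X.Pt × Y.Pt} (hz : (X.prod Y).IsRational z) : X.IsRational z.1 := by
  obtain ⟨a, ha, h⟩ := hz
  obtain ⟨c, hc, hrep⟩ := exists_rep_eq_smul h
  obtain ⟨c', hc', hseg⟩ := exists_segre_rep (X.emb z.1) (Y.emb z.2)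
  obtain ⟨⟨i₀, j₀⟩, h0⟩ := Function.ne_iff.1 ha
  have key (i : X.coord) : c' * ((X.emb z.1).rep i * (Y.emb z.2).rep j₀) =
      c * algebraMap k (AlgebraicClosure k) (a (i, j₀)) := by
    rw [← hseg]
    exact congrFun hrep (i, j₀)
  have hne : (Y.emb z.2).rep j₀ ≠ 0 := by
    intro hb
    have := key i₀
    rw [hb, mul_zero, mul_zero] at this
    exact mul_ne_zero hc h0 this.symm
  refine ⟨fun i => a (i, j₀), Function.ne_iff.2 ⟨i₀, h0⟩, ?_⟩
  rw [← (X.emb z.1).mk_rep, Projectivization.mk_eq_mk_iff']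
  refine ⟨c / (c' * (Y.emb z.2).rep j₀), ?_⟩
  funext i
  simp only [Pi.smul_apply, smul_eq_mul]
  field_simp
  linear_combination -key i

theorem IsRational.snd {z : X.Pt × Y.Pt} (hz : (X.prod Y).IsRational z) : Y.IsRational z.2 := by
  obtain ⟨a, ha, h⟩ := hz
  obtain ⟨c, hc, hrep⟩ := exists_rep_eq_smul h
  obtain ⟨c', hc', hseg⟩ := exists_segre_rep (X.emb z.1) (Y.emb z.2)
  obtain ⟨⟨i₀, j₀⟩, h0⟩ := Function.ne_iff.1 ha
  have key (j : Y.coord) : c' * ((X.emb z.1).rep i₀ * (Y.emb z.2).rep j) =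
      c * algebraMap k (AlgebraicClosure k) (a (i₀, j)) := by
    rw [← hseg]
    exact congrFun hrep (i₀, j)
  have hne : (X.emb z.1).rep i₀ ≠ 0 := by
    intro hb
    have := key j₀
    rw [hb, zero_mul, mul_zero] at this
    exact mul_ne_zero hc h0 this.symm
  refine ⟨fun j => a (i₀, j), Function.ne_iff.2 ⟨j₀, h0⟩, ?_⟩
  rw [← (Y.emb z.2).mk_rep, Projectivization.mk_eq_mk_iff']
  refine ⟨c / (c' * (X.emb z.1).rep i₀), ?_⟩
  funext j
  simp only [Pi.smul_apply, smul_eq_mul]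
  field_simp
  linear_combination -key j

/-- The first component of a rational point of a product. -/
def RatPt.fst (z : (X.prod Y).RatPt) : X.RatPt := ⟨z.1.1, IsRational.fst z.2⟩

/-- The second component of a rational point of a product. -/
def RatPt.snd (z : (X.prod Y).RatPt) : Y.RatPt := ⟨z.1.2, IsRational.snd z.2⟩

/-! ### Comparison of heights -/

namespace LineBundle.GeneratingSections

variable {M : X.LineBundle}

/-- Some section of the first family is nonzero at `x`, and near `x` the quotient of the two
sections is a quotient of forms. This quotient does not depend on the trivialization. -/
theorem exists_local_relation (S S' : M.GeneratingSections) (l : S'.ι) (x : X.Pt) :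
    ∃ (d : ℕ) (m : S.ι) (F G : MvPolynomial X.coord k), F.IsHomogeneous d ∧ G.IsHomogeneous d ∧
      X.evalAt G x ≠ 0 ∧
      ∀ i, ∀ y ∈ M.U i, S'.s l i y * X.evalAt G y = X.evalAt F y * S.s m i y := by
  obtain ⟨i, hi⟩ := M.cover x
  obtain ⟨m, hm⟩ := S.exists_ne_zero i x hi
  obtain ⟨e, G₀, hG₀, hG₀x, hU⟩ := M.isOpen i x hi
  obtain ⟨d, A, B, hA, hB, hBx, hs⟩ := S.regular m i x hi
  obtain ⟨d', A', B', hA', hB', hBx', hs'⟩ := S'.regular l i x hi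
  have hAx : X.evalAt A x ≠ 0 := fun h => hm (by rw [hs x hi hBx, h, zero_div])
  have hG : (G₀ * A * B * B').IsHomogeneous (e + d + d + d') := ((hG₀.mul hA).mul hB).mul hB'
  have hF : (G₀ * B * B * A').IsHomogeneous (e + d + d + d') := ((hG₀.mul hB).mul hB).mul hA'
  -- The basic relation has factors `G₀BBA'` and `G₀ABB'`. Multiplying both once more by `G₀ABB'`
  -- makes the two sides vanish wherever the local formulas are not available, so the relation holds
  -- everywhere.
  refine ⟨_, m, G₀ * B * B * A' * (G₀ * A * B * B'), G₀ * A * B * B' * (G₀ * A * B * B'),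
    hF.mul hG, hG.mul hG, ?_, fun i' y hy => ?_⟩
  · simpa [evalAt] using! ⟨⟨⟨hG₀x, hAx⟩, hBx⟩, hBx'⟩
  · by_cases hz : X.evalAt (G₀ * A * B * B') y = 0
    · simp only [evalAt] at hz
      simp only [evalAt, map_mul (aeval _) _ (G₀ * A * B * B'), hz, mul_zero, zero_mul]
    · have hz' : ((X.evalAt G₀ y ≠ 0 ∧ X.evalAt A y ≠ 0) ∧ X.evalAt B y ≠ 0) ∧
          X.evalAt B' y ≠ 0 := by simpa [evalAt] using hz
      obtain ⟨⟨⟨h1, h2⟩, h3⟩, h4⟩ := hz'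
      have hyi := hU y h1
      rw [S.compat m i' i y ⟨hy, hyi⟩, S'.compat l i' i y ⟨hy, hyi⟩, hs y hyi h3,
        hs' y hyi h4]
      simp only [evalAt, map_mul] at h1 h2 h3 h4 ⊢
      field_simp

/-- A projective Nullstellensatz: an ideal that contains the dehomogenized
equations of `X` and, for each point `x` of `X`, a homogeneous polynomial that does not vanish
at `x`, is the unit ideal. -/
theorem ideal_eq_top (j : X.coord) (I : Ideal (MvPolynomial X.coord k))
    (hj : MvPolynomial.X j - 1 ∈ I)
    (hE : ∀ F : MvPolynomial X.coord k, (∃ d, F.IsHomogeneous d) →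
      (∀ x, X.evalAt F x = 0) → F ∈ I)
    (hG : ∀ x, ∃ (d : ℕ) (G : MvPolynomial X.coord k), G.IsHomogeneous d ∧ X.evalAt G x ≠ 0 ∧
      G ∈ I) : I = ⊤ := by
  have hempty : zeroLocus (AlgebraicClosure k) I = ∅ := by
    rw [Set.eq_empty_iff_forall_notMem]
    intro z hz
    have hzj : z j = 1 := by simpa [sub_eq_zero] using hz _ hj
    have hz0 : z ≠ 0 := fun h => by simp [h] at hzj
    obtain ⟨E, hEh, hX⟩ := X.closed
    obtain ⟨x, hx⟩ := (hX (Projectivization.mk _ z hz0)).2 (fun F hF => by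
      obtain ⟨d, hd⟩ := hEh F hF
      exact (aeval_mk_rep_eq_zero hz0 hd).2
        (hz F (hE F ⟨d, hd⟩ fun y => (hX _).1 ⟨y, rfl⟩ F hF)))
    obtain ⟨d, G, hGd, hGx, hGI⟩ := hG x
    refine hGx ?_
    rw [evalAt, hx, aeval_mk_rep_eq_zero hz0 hGd]
    exact hz G hGI
  have := vanishingIdeal_zeroLocus_eq_radical (K := AlgebraicClosure k) I
  rw [hempty, vanishingIdeal_empty] at this
  exact Ideal.radical_eq_top.1 this.symm

/-- The polynomials `p` for which `p` times the section `l` of `S'` is, on the chart `x_j = 1`, a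
polynomial combination of the sections of `S` form an ideal. By the local relations it contains, for
every point of `X`, a form not vanishing there, so `ideal_eq_top` puts `1` into it. -/
theorem exists_polynomial_relation (S S' : M.GeneratingSections) (l : S'.ι) (j : X.coord) :
    ∃ P : S.ι → MvPolynomial X.coord k, ∀ i, ∀ y ∈ M.U i,
      ∀ (a : X.coord → AlgebraicClosure k) (ha : a ≠ 0), X.emb y = Projectivization.mk _ a ha →
        a j = 1 → S'.s l i y = ∑ m, aeval a (P m) * S.s m i y := by
  classical
  let I : Ideal (MvPolynomial X.coord k) :=
    { carrier := {p | ∃ P : S.ι → MvPolynomial X.coord k, ∀ i, ∀ y ∈ M.U i,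
        ∀ (a : X.coord → AlgebraicClosure k) (ha : a ≠ 0), X.emb y = Projectivization.mk _ a ha →
          a j = 1 → aeval a p * S'.s l i y = ∑ m, aeval a (P m) * S.s m i y}
      zero_mem' := ⟨0, by simp⟩
      add_mem' := by
        rintro p q ⟨P, hP⟩ ⟨Q, hQ⟩
        refine ⟨P + Q, fun i y hy a ha h hj => ?_⟩
        rw [map_add, add_mul, hP i y hy a ha h hj, hQ i y hy a ha h hj, ← Finset.sum_add_distrib]
        exact Finset.sum_congr rfl fun m _ => by rw [Pi.add_apply, map_add, add_mul]
      smul_mem' := by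
        rintro q p ⟨P, hP⟩
        refine ⟨fun m => q * P m, fun i y hy a ha h hj => ?_⟩
        rw [smul_eq_mul, map_mul, mul_assoc, hP i y hy a ha h hj, Finset.mul_sum]
        exact Finset.sum_congr rfl fun m _ => by rw [map_mul, mul_assoc] }
  have htop : I = ⊤ := by
    refine ideal_eq_top j I ⟨0, fun i y hy a ha h hj => by simp [hj]⟩ ?_ ?_
    · rintro F ⟨d, hd⟩ hF
      refine ⟨0, fun i y hy a ha h hj => ?_⟩
      have : aeval a F = 0 := by
        rw [← aeval_mk_rep_eq_zero ha hd, ← h]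
        exact hF y
      simp [this]
    · intro x
      obtain ⟨d, m₀, F, G, hF, hG, hGx, hrel⟩ := exists_local_relation S S' l x
      refine ⟨d, G, hG, hGx, fun m => if m = m₀ then F else 0, fun i y hy a ha h hj => ?_⟩
      obtain ⟨c, hc, he⟩ := exists_evalAt_eq h
      have := hrel i y hy
      rw [he d F hF, he d G hG] at this
      have key : aeval a G * S'.s l i y = aeval a F * S.s m₀ i y := by
        refine mul_left_cancel₀ (pow_ne_zero d hc) ?_
        linear_combination this
      rw [key, Finset.sum_eq_single m₀]
      · simp
      · intro m _ hm
        simp [hm]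
      · simp
  obtain ⟨P, hP⟩ := (Ideal.eq_top_iff_one I).1 htop
  exact ⟨P, fun i y hy a ha h hj => by simpa using hP i y hy a ha h hj⟩

variable [NumberField k]

/-- Heights defined by two generating families of sections of the same line bundle agree up to
bounded factors. -/
theorem exists_height_le (S S' : M.GeneratingSections) :
    ∃ C : ℝ, 0 < C ∧ ∀ x, S'.height x ≤ C * S.height x := by
  choose P hP using fun j l => exists_polynomial_relation S S' l j
  obtain ⟨C, hC, hle⟩ := exists_mulHeight_le_of_polynomial_matrix P
  refine ⟨C ^ ((Module.finrank ℚ k : ℝ)⁻¹), by positivity, fun x => ?_⟩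
  obtain ⟨i, hi⟩ := M.cover x.1
  obtain ⟨w, hw0, hw⟩ := S.exists_values x hi
  obtain ⟨w', hw0', hw'⟩ := S'.exists_values x hi
  rw [S.height_eq x hi hw, S'.height_eq x hi hw',
    ← Real.mul_rpow hC.le (Height.mulHeight_pos _).le]
  refine Real.rpow_le_rpow (Height.mulHeight_pos _).le
    (hle x.coords w w' x.coords_ne_zero hw0 hw0' fun j hj l => ?_) (by positivity)
  have hj' : algebraMap k (AlgebraicClosure k) (x.coords j) ≠ 0 := by simpa using hj
  let a : X.coord → AlgebraicClosure k := fun i =>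
    algebraMap k (AlgebraicClosure k) (x.coords i / x.coords j)
  have haj : a j = 1 := by simp [a, hj]
  have ha : a ≠ 0 := fun h => by simp [h] at haj
  have hemb : X.emb x.1 = Projectivization.mk _ a ha := by
    rw [x.emb_eq, Projectivization.mk_eq_mk_iff']
    refine ⟨algebraMap k _ (x.coords j), ?_⟩
    funext i
    simp only [a, Pi.smul_apply, smul_eq_mul, ← map_mul]
    congr 1
    field_simp
  apply (algebraMap k (AlgebraicClosure k)).injective
  rw [hw' l, hP j l i x.1 hi a ha hemb haj, map_sum]
  refine Finset.sum_congr rfl fun m _ => ?_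
  rw [map_mul, hw, ← coe_aeval_eq_eval]
  congr 1
  exact aeval_algebraMap_apply (AlgebraicClosure k) _ _

end LineBundle.GeneratingSections

/-! ### Weil heights: independence of choices, and products -/

variable [NumberField k]

theorem IsWeilHeight.pos {L : X.LineBundle} {H : X.RatPt → ℝ} (hH : IsWeilHeight L H)
    (x : X.RatPt) : 0 < H x := by
  obtain ⟨B, t, s, C, hC, h⟩ := hH
  exact lt_of_lt_of_le (mul_pos (inv_pos.2 hC) (div_pos (s.height_pos x) (t.height_pos x))) (h x).1

/-- A Weil height for `L` is bounded by any other one, up to a factor. -/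
theorem IsWeilHeight.exists_le {L : X.LineBundle} {H H' : X.RatPt → ℝ} (hH : IsWeilHeight L H)
    (hH' : IsWeilHeight L H') : ∃ C : ℝ, 0 < C ∧ ∀ x, H' x ≤ C * H x := by
  obtain ⟨B, t, s, C, hC, h⟩ := hH
  obtain ⟨B', t', s', C', hC', h'⟩ := hH'
  -- Cross-multiplication: `s ⊗ t'` and `s' ⊗ t` both generate `L ⊗ B ⊗ B'`, once the factors are
  -- permuted.
  obtain ⟨D, hD, hle⟩ := LineBundle.GeneratingSections.exists_height_le (s.tensor t')
    ((s'.tensor t).reindex (M := (L.tensor B).tensor B')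
      (fun i => ((i.1.1, i.2), i.1.2)) (fun i x hx => ⟨⟨hx.1.1, hx.2⟩, hx.1.2⟩)
      (fun i j x _ => by
        change L.g _ _ x * B.g _ _ x * B'.g _ _ x = L.g _ _ x * B'.g _ _ x * B.g _ _ x
        ring))
  refine ⟨C' * D * C, by positivity, fun x => (h' x).2.trans ?_⟩
  have hx := (LineBundle.GeneratingSections.height_reindex _ _ _ _ x).symm.le.trans (hle x)
  rw [LineBundle.GeneratingSections.height_tensor,
    LineBundle.GeneratingSections.height_tensor] at hx
  have ht := t.height_pos x
  have ht' := t'.height_pos x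
  have h1 : s'.height x / t'.height x ≤ D * (s.height x / t.height x) := by
    rw [div_le_iff₀ ht', mul_assoc, div_mul_eq_mul_div, mul_div_assoc', le_div_iff₀ ht]
    exact hx
  have h2 : s.height x / t.height x ≤ C * H x := by
    have := (h x).1
    rwa [inv_mul_le_iff₀ hC] at this
  calc C' * (s'.height x / t'.height x) ≤ C' * (D * (C * H x)) := by 
        gcongr
        exact h1.trans (by gcongr)
    _ = C' * D * C * H x := by ring

/-- The product of Weil heights on the factors is a Weil height for the external tensor
product. -/
theorem IsWeilHeight.prod {L : X.LineBundle} {M : Y.LineBundle} {H : X.RatPt → ℝ}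
    {H' : Y.RatPt → ℝ} (hH : IsWeilHeight L H) (hH' : IsWeilHeight M H') :
    IsWeilHeight ((L.pullback (ProjVariety.fst X Y)).tensor (M.pullback (ProjVariety.snd X Y)))
      (fun z => H z.fst * H' z.snd) := by
  have hpos := hH.pos
  have hpos' := hH'.pos
  obtain ⟨B, t, s, C, hC, h⟩ := hH
  obtain ⟨B', t', s', C', hC', h'⟩ := hH'
  obtain ⟨T, hT⟩ : ∃ T : ((B.pullback (ProjVariety.fst X Y)).tensor
      (B'.pullback (ProjVariety.snd X Y))).GeneratingSections,
      ∀ z, T.height z = t.height z.fst * t'.height z.snd :=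
    ⟨(t.pullback _).tensor (t'.pullback _), fun z =>
      (LineBundle.GeneratingSections.height_tensor _ _ z).trans (congrArg₂ (· * ·)
        (t.height_pullback (ProjVariety.fst X Y) (x := z) (y := z.fst) rfl)
        (t'.height_pullback (ProjVariety.snd X Y) (x := z) (y := z.snd) rfl))⟩
  obtain ⟨S, hS⟩ : ∃ S : (((L.pullback (ProjVariety.fst X Y)).tensor
      (M.pullback (ProjVariety.snd X Y))).tensor ((B.pullback (ProjVariety.fst X Y)).tensor
      (B'.pullback (ProjVariety.snd X Y)))).GeneratingSections,
      ∀ z, S.height z = s.height z.fst * s'.height z.snd :=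
    ⟨((s.pullback _).tensor (s'.pullback _)).reindex
      (fun i => ((i.1.1, i.2.1), (i.1.2, i.2.2)))
      (fun i x hx => ⟨⟨hx.1.1, hx.2.1⟩, ⟨hx.1.2, hx.2.2⟩⟩)
      (fun i j x _ => by
        change (L.g _ _ x.1 * M.g _ _ x.2) * (B.g _ _ x.1 * B'.g _ _ x.2) =
          (L.g _ _ x.1 * B.g _ _ x.1) * (M.g _ _ x.2 * B'.g _ _ x.2)
        ring), fun z =>
      ((LineBundle.GeneratingSections.height_reindex _ _ _ _ z).trans
        (LineBundle.GeneratingSections.height_tensor _ _ z)).trans (congrArg₂ (· * ·)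
          (s.height_pullback (ProjVariety.fst X Y) (x := z) (y := z.fst) rfl)
          (s'.height_pullback (ProjVariety.snd X Y) (x := z) (y := z.snd) rfl))⟩
  refine ⟨_, T, S, C * C', mul_pos hC hC', fun z => ?_⟩
  rw [hS, hT, ← div_mul_div_comm]
  have p1 := div_pos (s.height_pos z.fst) (t.height_pos z.fst)
  have p2 := div_pos (s'.height_pos z.snd) (t'.height_pos z.snd)
  constructor
  · rw [mul_inv, mul_mul_mul_comm]
    exact mul_le_mul (h _).1 (h' _).1 (by positivity) (hpos _).le
  · rw [mul_mul_mul_comm]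
    exact mul_le_mul (h _).2 (h' _).2 (hpos' _).le (by positivity)

end ProjVariety

end

noncomputable section

/-! ### The projective distance for one absolute value -/

section ProjDist

variable {k : Type*} [Field k] {σ τ : Type*}

/-- The distance of two points of projective space, given by homogeneous coordinates. -/
def projDist (w : AbsoluteValue k ℝ) (a b : σ → k) : ℝ :=
  (⨆ ij : σ × σ, w (a ij.1 * b ij.2 - a ij.2 * b ij.1)) / ((⨆ i, w (a i)) * ⨆ j, w (b j))

theorem projDist_nonneg (w : AbsoluteValue k ℝ) (a b : σ → k) : 0 ≤ projDist w a b :=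
  div_nonneg (Real.iSup_nonneg fun _ => w.nonneg _)
    (mul_nonneg (Real.iSup_nonneg fun _ => w.nonneg _) (Real.iSup_nonneg fun _ => w.nonneg _))

theorem projDist_smul (w : AbsoluteValue k ℝ) (a b : σ → k) {c d : k} (hc : c ≠ 0) (hd : d ≠ 0) :
    projDist w (c • a) (d • b) = projDist w a b := by
  have h (ij : σ × σ) : w ((c • a) ij.1 * (d • b) ij.2 - (c • a) ij.2 * (d • b) ij.1) =
      (w c * w d) * w (a ij.1 * b ij.2 - a ij.2 * b ij.1) := by
    rw [← map_mul, ← map_mul]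
    congr 1
    simp only [Pi.smul_apply, smul_eq_mul]
    ring
  have hc' := w.pos hc
  have hd' := w.pos hd
  simp only [projDist, h]
  simp only [Pi.smul_apply, smul_eq_mul, map_mul]
  rw [← Real.mul_iSup_of_nonneg (by positivity), ← Real.mul_iSup_of_nonneg hc'.le,
    ← Real.mul_iSup_of_nonneg hd'.le, mul_mul_mul_comm (w c), mul_div_mul_left]
  positivity

theorem projDist_comp_equiv (w : AbsoluteValue k ℝ) (a b : σ → k) (e : τ ≃ σ) :
    projDist w (a ∘ e) (b ∘ e) = projDist w a b := by
  simp only [projDist, Function.comp_apply]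
  rw [e.iSup_comp (g := fun i => w (a i)), e.iSup_comp (g := fun i => w (b i)),
    ← (e.prodCongr e).iSup_comp (g := fun ij : σ × σ => w (a ij.1 * b ij.2 - a ij.2 * b ij.1))]
  rfl

/-- Coordinates of a point of projective space all of which have absolute value at most one, and
one of which equals one. -/
def IsNormalized (w : AbsoluteValue k ℝ) (a : σ → k) : Prop :=
  (∃ i, a i = 1) ∧ ∀ i, w (a i) ≤ 1

theorem exists_isNormalized_smul [Finite σ] (w : AbsoluteValue k ℝ) {a : σ → k} (ha : a ≠ 0) :
    ∃ c : k, c ≠ 0 ∧ IsNormalized w (c • a) := by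
  obtain ⟨i₀, hi₀⟩ := Function.ne_iff.1 ha
  have : Nonempty σ := ⟨i₀⟩
  obtain ⟨i, hi⟩ := Finite.exists_max fun i => w (a i)
  have hai : a i ≠ 0 := w.pos_iff.1 ((w.pos hi₀).trans_le (hi i₀))
  refine ⟨(a i)⁻¹, inv_ne_zero hai, ⟨i, by simp [hai]⟩, fun j => ?_⟩
  have := w.pos hai
  simp only [Pi.smul_apply, smul_eq_mul, map_mul, map_inv₀]
  rw [inv_mul_le_iff₀ this, mul_one]
  exact hi j

namespace IsNormalized

variable {w : AbsoluteValue k ℝ} {a a' : σ → k} {b b' : τ → k}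

theorem iSup_eq_one [Finite σ] (ha : IsNormalized w a) : ⨆ i, w (a i) = 1 := by
  obtain ⟨⟨i, hi⟩, h⟩ := ha
  have : Nonempty σ := ⟨i⟩
  exact le_antisymm (ciSup_le h) (Finite.le_ciSup_of_le i (by simp [hi]))

theorem projDist_eq [Finite σ] (ha : IsNormalized w a) (ha' : IsNormalized w a') :
    projDist w a a' = ⨆ ij : σ × σ, w (a ij.1 * a' ij.2 - a ij.2 * a' ij.1) := by
  rw [projDist, ha.iSup_eq_one, ha'.iSup_eq_one, mul_one, div_one]

theorem minor_le [Finite σ] (ha : IsNormalized w a) (ha' : IsNormalized w a') (i j : σ) :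
    w (a i * a' j - a j * a' i) ≤ projDist w a a' := by
  rw [ha.projDist_eq ha']
  exact Finite.le_ciSup (fun ij : σ × σ => w (a ij.1 * a' ij.2 - a ij.2 * a' ij.1)) (i, j)

theorem projDist_le [Finite σ] (ha : IsNormalized w a) (ha' : IsNormalized w a') {D : ℝ}
    (h : ∀ i j, w (a i * a' j - a j * a' i) ≤ D) : projDist w a a' ≤ D := by
  rw [ha.projDist_eq ha']
  obtain ⟨i, -⟩ := ha.1
  have : Nonempty (σ × σ) := ⟨(i, i)⟩
  exact ciSup_le fun ij => h _ _

theorem tensor (ha : IsNormalized w a) (hb : IsNormalized w b) :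
    IsNormalized w (fun ij : σ × τ => a ij.1 * b ij.2) := by
  obtain ⟨⟨i, hi⟩, ha⟩ := ha
  obtain ⟨⟨j, hj⟩, hb⟩ := hb
  refine ⟨⟨(i, j), by simp [hi, hj]⟩, fun ij => ?_⟩
  rw [map_mul]
  exact mul_le_one₀ (ha _) (w.nonneg _) (hb _)

variable [Finite σ] [Finite τ]

theorem projDist_le_two (ha : IsNormalized w a) (ha' : IsNormalized w a') :
    projDist w a a' ≤ 2 := by
  refine ha.projDist_le ha' fun i j => ?_
  have h1 : w (a i * a' j) ≤ 1 := by
    rw [map_mul]; exact mul_le_one₀ (ha.2 _) (w.nonneg _) (ha'.2 _)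
  have h2 : w (a j * a' i) ≤ 1 := by
    rw [map_mul]; exact mul_le_one₀ (ha.2 _) (w.nonneg _) (ha'.2 _)
  have := w.sub_le (a i * a' j) 0 (a j * a' i)
  simp only [sub_zero, zero_sub, w.map_neg] at this
  linarith

/-- With `a i = 1` and `a' j = 1`, the minor on `i`, `j` is `1 - a j * a' i`. Thus a coordinate that
is large for `a` stays away from zero for nearby points. -/
theorem one_sub_projDist_le (ha : IsNormalized w a) (ha' : IsNormalized w a') {i : σ}
    (hi : a i = 1) : 1 - projDist w a a' ≤ w (a' i) := by
  obtain ⟨j, hj⟩ := ha'.1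
  have h1 := ha.minor_le ha' i j
  rw [hi, hj, one_mul] at h1
  have h2 := w.sub_le 1 (a j * a' i) 0
  simp only [sub_zero, map_one] at h2
  have h3 : w (a j * a' i) ≤ w (a' i) := by
    rw [map_mul]
    exact mul_le_of_le_one_left (w.nonneg _) (ha.2 j)
  linarith

theorem projDist_tensor_le (ha : IsNormalized w a) (ha' : IsNormalized w a')
    (hb : IsNormalized w b) (hb' : IsNormalized w b') :
    projDist w (fun ij : σ × τ => a ij.1 * b ij.2) (fun ij => a' ij.1 * b' ij.2) ≤
      projDist w a a' + projDist w b b' := by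
  refine (ha.tensor hb).projDist_le (ha'.tensor hb') ?_
  rintro ⟨i, j⟩ ⟨m, l⟩
  -- Exchanging one tensor factor at a time gives a sum of minors of the factors with coefficients
  -- of absolute value at most one.
  have e : a i * b j * (a' m * b' l) - a m * b l * (a' i * b' j) =
      (a i * a' m - a m * a' i) * (b j * b' l) + a m * a' i * (b j * b' l - b l * b' j) := by
    ring
  simp only
  rw [e]
  refine (w.add_le _ _).trans (add_le_add ?_ ?_)
  · rw [map_mul, map_mul w (b j)]
    exact (mul_le_of_le_one_right (w.nonneg _)
      (mul_le_one₀ (hb.2 _) (w.nonneg _) (hb'.2 _))).trans (ha.minor_le ha' _ _)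
  · rw [map_mul, map_mul w (a m)]
    exact (mul_le_of_le_one_left (w.nonneg _)
      (mul_le_one₀ (ha.2 _) (w.nonneg _) (ha'.2 _))).trans (hb.minor_le hb' _ _)

/-- If `D ≥ 1/2`, the trivial bound `2` is at most `4 * D`. Otherwise `b' j₀` has absolute value at
least `1 - D > 1/2` at an index with `b j₀ = 1`, and it can be divided out of the minors with second
index `j₀`. -/
theorem projDist_le_tensor (ha : IsNormalized w a) (ha' : IsNormalized w a')
    (hb : IsNormalized w b) (hb' : IsNormalized w b') :
    projDist w a a' ≤
      4 * projDist w (fun ij : σ × τ => a ij.1 * b ij.2) (fun ij => a' ij.1 * b' ij.2) := by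
  set D := projDist w (fun ij : σ × τ => a ij.1 * b ij.2) (fun ij => a' ij.1 * b' ij.2)
  rcases le_or_gt (1 / 2) D with hD | hD
  · have := ha.projDist_le_two ha'
    linarith
  · obtain ⟨i₀, hi₀⟩ := ha.1
    obtain ⟨j₀, hj₀⟩ := hb.1
    have h1 : 1 - D ≤ w (a' i₀ * b' j₀) :=
      (ha.tensor hb).one_sub_projDist_le (ha'.tensor hb') (i := (i₀, j₀)) (by simp [hi₀, hj₀])
    have h2 : w (a' i₀ * b' j₀) ≤ w (b' j₀) := by
      rw [map_mul]
      exact mul_le_of_le_one_left (w.nonneg _) (ha'.2 _)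
    refine ha.projDist_le ha' fun i m => ?_
    have h3 := (ha.tensor hb).minor_le (ha'.tensor hb') (i, j₀) (m, j₀)
    simp only [hj₀, mul_one] at h3
    have e : a i * (a' m * b' j₀) - a m * (a' i * b' j₀) = (a i * a' m - a m * a' i) * b' j₀ := by
      ring
    rw [e, map_mul] at h3
    change _ ≤ D at h3
    have h4 := w.nonneg (a i * a' m - a m * a' i)
    nlinarith

end IsNormalized

/-! ### Comparison of distances in arbitrary homogeneous coordinates -/

theorem smul_tensor_smul (c d : k) (a : σ → k) (b : τ → k) :
    (fun ij : σ × τ => (c • a) ij.1 * (d • b) ij.2) =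
      (c * d) • fun ij : σ × τ => a ij.1 * b ij.2 := by
  funext ij
  simp only [Pi.smul_apply, smul_eq_mul]
  ring

variable [Finite σ] [Finite τ] (w : AbsoluteValue k ℝ) {a a' : σ → k} {b b' : τ → k}

theorem projDist_tensor_le (ha : a ≠ 0) (ha' : a' ≠ 0) (hb : b ≠ 0) (hb' : b' ≠ 0) :
    projDist w (fun ij : σ × τ => a ij.1 * b ij.2) (fun ij => a' ij.1 * b' ij.2) ≤
      projDist w a a' + projDist w b b' := by
  obtain ⟨c, hc, na⟩ := exists_isNormalized_smul w ha
  obtain ⟨c', hc', na'⟩ := exists_isNormalized_smul w ha'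
  obtain ⟨d, hd, nb⟩ := exists_isNormalized_smul w hb
  obtain ⟨d', hd', nb'⟩ := exists_isNormalized_smul w hb'
  have := na.projDist_tensor_le na' nb nb'
  rwa [smul_tensor_smul, smul_tensor_smul, projDist_smul w _ _ hc hc', projDist_smul w _ _ hd hd',
    projDist_smul w _ _ (mul_ne_zero hc hd) (mul_ne_zero hc' hd')] at this

theorem projDist_le_tensor_left (ha : a ≠ 0) (ha' : a' ≠ 0) (hb : b ≠ 0) (hb' : b' ≠ 0) :
    projDist w a a' ≤
      4 * projDist w (fun ij : σ × τ => a ij.1 * b ij.2) (fun ij => a' ij.1 * b' ij.2) := by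
  obtain ⟨c, hc, na⟩ := exists_isNormalized_smul w ha
  obtain ⟨c', hc', na'⟩ := exists_isNormalized_smul w ha'
  obtain ⟨d, hd, nb⟩ := exists_isNormalized_smul w hb
  obtain ⟨d', hd', nb'⟩ := exists_isNormalized_smul w hb'
  have := na.projDist_le_tensor na' nb nb'
  rwa [smul_tensor_smul, smul_tensor_smul, projDist_smul w _ _ hc hc',
    projDist_smul w _ _ (mul_ne_zero hc hd) (mul_ne_zero hc' hd')] at this

theorem projDist_le_tensor_right (ha : a ≠ 0) (ha' : a' ≠ 0) (hb : b ≠ 0) (hb' : b' ≠ 0) :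
    projDist w b b' ≤
      4 * projDist w (fun ij : σ × τ => a ij.1 * b ij.2) (fun ij => a' ij.1 * b' ij.2) := by
  refine (projDist_le_tensor_left w hb hb' ha ha').trans_eq ?_
  rw [← projDist_comp_equiv w _ _ (Equiv.prodComm σ τ)]
  congr 2 <;> funext ij <;> exact mul_comm _ _

/-- Points that are close to `a` have affine coordinates close to those of `a`. -/
theorem exists_smul_sub_le (ha : IsNormalized w a) (ha' : a' ≠ 0)
    (h : projDist w a a' ≤ 1 / 2) :
    ∃ c : k, c ≠ 0 ∧ ∀ j, w (c * a' j - a j) ≤ 2 * projDist w a a' := by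
  obtain ⟨c', hc', na'⟩ := exists_isNormalized_smul w ha'
  have e : projDist w a (c' • a') = projDist w a a' := by
    simpa using projDist_smul w a a' one_ne_zero hc'
  rw [← e] at h ⊢
  obtain ⟨i, hi⟩ := ha.1
  have h1 := ha.one_sub_projDist_le na' hi
  set b := c' • a' with hb
  have hbi : b i ≠ 0 := w.pos_iff.1 (by linarith)
  -- This scaling makes the `i`-th coordinate `1`, as for `a`; the factor `2` comes from `w (b i) ≥
  -- 1/2`.
  refine ⟨c' / b i, div_ne_zero hc' hbi, fun j => ?_⟩
  have h2 := ha.minor_le na' i j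
  rw [hi, one_mul] at h2
  have e2 : c' / b i * a' j - a j = (b j - a j * b i) / b i := by
    have : b j = c' * a' j := rfl
    rw [this]
    field_simp
  rw [e2, map_div₀, div_le_iff₀ (w.pos hbi)]
  have := projDist_nonneg w a b
  nlinarith

end ProjDist

namespace ProjVariety

variable {k : Type u} [Field k] {X Y : ProjVariety k}

/-! ### Distances on varieties -/

/-- Tuples over `k` that are proportional over the algebraic closure are proportional over `k`, the
factor being a quotient of entries. -/
theorem RatPt.exists_coords_eq_smul (x : X.RatPt) {a : X.coord → k}
    (ha : (fun i => algebraMap k (AlgebraicClosure k) (a i)) ≠ 0)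
    (h : X.emb x.1 = Projectivization.mk _ _ ha) : ∃ c : k, c ≠ 0 ∧ x.coords = c • a := by
  rw [x.emb_eq, Projectivization.mk_eq_mk_iff'] at h
  obtain ⟨c, hc⟩ := h
  have hc (i : X.coord) := congrFun hc i
  simp only [Pi.smul_apply, smul_eq_mul] at hc
  obtain ⟨i, hi⟩ := Function.ne_iff.1 ha
  have hi' : a i ≠ 0 := fun h => hi (by simp [h])
  have e : c = algebraMap k _ (x.coords i / a i) := by
    rw [map_div₀, ← hc i]
    exact (mul_div_cancel_right₀ c hi).symm
  have hx : x.coords = (x.coords i / a i) • a := by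
    funext j
    apply (algebraMap k (AlgebraicClosure k)).injective
    rw [← hc j, e, ← map_mul]
    rfl
  refine ⟨_, fun h0 => x.coords_ne_zero ?_, hx⟩
  rw [hx, h0, zero_smul]

theorem RatPt.exists_coords_pair_eq_smul (x : X.RatPt) (y : Y.RatPt) :
    ∃ c : k, c ≠ 0 ∧
      (x.pair y).coords = c • fun ij : X.coord × Y.coord => x.coords ij.1 * y.coords ij.2 := by
  have h := segre_ne_zero x.coords_ne_zero_map y.coords_ne_zero_map
  refine (x.pair y).exists_coords_eq_smul (a := fun ij : X.coord × Y.coord =>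
    x.coords ij.1 * y.coords ij.2) (by simpa only [map_mul] using! h) ?_
  change segre (X.emb x.1) (Y.emb y.1) = _
  rw [x.emb_eq, y.emb_eq, segre_mk]
  congr 1
  funext ij
  simp

theorem projDist_pair (w : AbsoluteValue k ℝ) (x x' : X.RatPt) (y y' : Y.RatPt) :
    projDist w (x.pair y).coords (x'.pair y').coords =
      projDist w (fun ij : X.coord × Y.coord => x.coords ij.1 * y.coords ij.2)
        (fun ij : X.coord × Y.coord => x'.coords ij.1 * y'.coords ij.2) := by
  obtain ⟨c, hc, h⟩ := x.exists_coords_pair_eq_smul y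
  obtain ⟨c', hc', h'⟩ := x'.exists_coords_pair_eq_smul y'
  rw [h, h']
  exact projDist_smul w _ _ hc hc'

variable [NumberField k]

theorem dist_eq_sum (x y : X.RatPt) :
    dist x y = ∑ v : NumberField.InfinitePlace k, projDist v.1 x.coords y.coords := rfl

theorem dist_nonneg (x y : X.RatPt) : 0 ≤ dist x y :=
  Finset.sum_nonneg fun v _ => projDist_nonneg v.1 _ _

theorem projDist_le_dist (v : NumberField.InfinitePlace k) (x y : X.RatPt) :
    projDist v.1 x.coords y.coords ≤ dist x y := by
  rw [dist_eq_sum]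
  exact Finset.single_le_sum (f := fun v : NumberField.InfinitePlace k =>
    projDist v.1 x.coords y.coords) (fun v _ => projDist_nonneg v.1 _ _) (Finset.mem_univ v)

theorem dist_self (x : X.RatPt) : dist x x = 0 := by
  rw [dist_eq_sum]
  exact Finset.sum_eq_zero fun v _ => by simp [projDist, mul_comm]

theorem dist_pair_le (x x' : X.RatPt) (y y' : Y.RatPt) :
    dist (x.pair y) (x'.pair y') ≤ dist x x' + dist y y' := by
  simp only [dist_eq_sum, projDist_pair, ← Finset.sum_add_distrib]
  exact Finset.sum_le_sum fun v _ => projDist_tensor_le v.1 x.coords_ne_zero x'.coords_ne_zero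
    y.coords_ne_zero y'.coords_ne_zero

theorem dist_left_le (x x' : X.RatPt) (y y' : Y.RatPt) :
    dist x x' ≤ 4 * dist (x.pair y) (x'.pair y') := by
  simp only [dist_eq_sum, projDist_pair, Finset.mul_sum]
  exact Finset.sum_le_sum fun v _ => projDist_le_tensor_left v.1 x.coords_ne_zero
    x'.coords_ne_zero y.coords_ne_zero y'.coords_ne_zero

theorem dist_right_le (x x' : X.RatPt) (y y' : Y.RatPt) :
    dist y y' ≤ 4 * dist (x.pair y) (x'.pair y') := by
  simp only [dist_eq_sum, projDist_pair, Finset.mul_sum]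
  exact Finset.sum_le_sum fun v _ => projDist_le_tensor_right v.1 x.coords_ne_zero
    x'.coords_ne_zero y.coords_ne_zero y'.coords_ne_zero

/-- A Zariski open neighbourhood contains all rational points that are close enough. -/
theorem IsZariskiOpen.exists_dist_lt {U : Set X.Pt} (hU : X.IsZariskiOpen U) {P : X.RatPt}
    (hP : P.1 ∈ U) : ∃ ε : ℝ, 0 < ε ∧ ∀ y : X.RatPt, dist P y < ε → y.1 ∈ U := by
  obtain ⟨d, G, hG, hGP, hsub⟩ := hU P.1 hP
  obtain ⟨v⟩ : Nonempty (NumberField.InfinitePlace k) := inferInstance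
  obtain ⟨c, hc, ha⟩ := exists_isNormalized_smul v.1 P.coords_ne_zero
  set a := c • P.coords with haP
  have hom (c : k) (b : X.coord → k) : eval (fun i => c * b i) G = c ^ d * eval b G := by
    simpa only [coe_aeval_eq_eval] using! aeval_smul_of_isHomogeneous (K := k) hG c b
  have hz (y : X.RatPt) : X.evalAt G y.1 ≠ 0 ↔ eval y.coords G ≠ 0 := by
    obtain ⟨e, he, h⟩ := y.exists_evalAt_eq
    rw [h d G hG]
    simp [he]
  have hGa : eval a G ≠ 0 := by
    have := hom c P.coords
    change eval a G = _ at this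
    rw [this]
    exact mul_ne_zero (pow_ne_zero _ hc) ((hz P).1 hGP)
  -- A single archimedean place suffices: in `ℂ`, nonvanishing of `G` is an open condition.
  let φ := v.embedding
  have hφ (b : X.coord → k) : eval (fun i => φ (b i)) (map φ G) = φ (eval b G) := by
    rw [eval_map]
    exact (eval₂_comp φ b G).symm
  have hne : eval (fun i => φ (a i)) (map φ G) ≠ 0 := by
    rw [hφ]
    simpa using hGa
  obtain ⟨δ, hδ, hball⟩ := Metric.eventually_nhds_iff.1
    ((MvPolynomial.continuous_eval (map φ G)).continuousAt.eventually_ne hne)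
  -- The bound `1/2` allows `exists_smul_sub_le`, and `δ / 2` absorbs its factor `2`.
  refine ⟨min (1 / 2) (δ / 2), by positivity, fun y hy => hsub _ ((hz y).2 fun h0 => ?_)⟩
  have hPy : projDist v.1 a y.coords = projDist v.1 P.coords y.coords := by
    simpa using projDist_smul v.1 P.coords y.coords hc one_ne_zero
  have hlt : projDist v.1 a y.coords < min (1 / 2) (δ / 2) := by
    rw [hPy]
    exact (projDist_le_dist v P y).trans_lt hy
  obtain ⟨e, he, hle⟩ := exists_smul_sub_le v.1 ha y.coords_ne_zero
    (hlt.le.trans (min_le_left _ _))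
  refine hball (y := fun i => φ (e * y.coords i)) ?_ ?_
  · rw [dist_pi_lt_iff hδ]
    intro i
    rw [dist_eq_norm, ← map_sub, NumberField.InfinitePlace.norm_embedding_eq]
    have := hlt.trans_le (min_le_right _ _)
    exact (hle i).trans_lt (by linarith)
  · rw [hφ, hom, h0, mul_zero, map_zero]

end ProjVariety

end

namespace ProjVariety

variable {k : Type u} [Field k] {X Y : ProjVariety k}

theorem RatPt.pair_eq_pair_iff {x x' : X.RatPt} {y y' : Y.RatPt} :
    x.pair y = x'.pair y' ↔ x = x' ∧ y = y' := by
  refine ⟨fun h => ⟨congrArg RatPt.fst h, congrArg RatPt.snd h⟩, ?_⟩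
  rintro ⟨rfl, rfl⟩
  rfl

theorem BoundedBelowNear.prod {P : X.RatPt} {Q : Y.RatPt} {HX : X.RatPt → ℝ}
    {HY : Y.RatPt → ℝ} {HL : (X.prod Y).RatPt → ℝ} {C : ℝ}
    (hP : BoundedBelowNear HX P) (hQ : BoundedBelowNear HY Q)
    (hC : 0 < C) (hle : ∀ z, HX z.fst * HY z.snd ≤ C * HL z) :
    BoundedBelowNear HL (P.pair Q) := by
  obtain ⟨U, hU, hPU, c, hc, hcU⟩ := hP
  obtain ⟨V, hV, hQV, d, hd, hdV⟩ := hQ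
  refine ⟨_, ((ProjVariety.fst X Y).isOpen_preimage U hU).inter
    ((ProjVariety.snd X Y).isOpen_preimage V hV), ⟨hPU, hQV⟩, c * d / C, by positivity,
    fun z hz => ?_⟩
  rw [div_lt_iff₀ hC, mul_comm (HL z)]
  have h1 := hcU z.fst hz.1
  have h2 := hdV z.snd hz.2
  exact (mul_lt_mul'' h1 h2 hc.le hd.le).trans_le (hle z)

variable [NumberField k]

/-! ### Comparison of approximation conditions -/

theorem FiniteLimsup.of_comparable {H : X.RatPt → ℝ} {H' : Y.RatPt → ℝ} {P : X.RatPt}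
    {P' : Y.RatPt} {S : ℕ → X.RatPt} {S' : ℕ → Y.RatPt} {a c C : ℝ}
    (h : FiniteLimsup H P S a) (ha : 0 ≤ a) (hc : 0 ≤ c) (hC : 0 ≤ C) (hH' : ∀ x, 0 ≤ H' x)
    (hd : ∀ i, dist P' (S' i) ≤ c * dist P (S i))
    (hH : ∀ᶠ i in atTop, H' (S' i) ≤ C * H (S i)) : FiniteLimsup H' P' S' a := by
  obtain ⟨M, hM⟩ := h
  refine ⟨c ^ a * C * M, eventually_map.2 ?_⟩
  filter_upwards [eventually_map.1 hM, hH] with i h1 h2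
  have h3 : dist P' (S' i) ^ a ≤ c ^ a * dist P (S i) ^ a := by
    rw [← Real.mul_rpow hc (dist_nonneg _ _)]
    exact Real.rpow_le_rpow (dist_nonneg _ _) (hd i) ha
  calc dist P' (S' i) ^ a * H' (S' i)
      ≤ (c ^ a * dist P (S i) ^ a) * (C * H (S i)) :=
        mul_le_mul h3 h2 (hH' _) ((Real.rpow_nonneg (dist_nonneg _ _) _).trans h3)
    _ = c ^ a * C * (dist P (S i) ^ a * H (S i)) := by ring
    _ ≤ c ^ a * C * M := by gcongr

theorem tendsto_dist_of_le {P : X.RatPt} {P' : Y.RatPt} {S : ℕ → X.RatPt} {S' : ℕ → Y.RatPt}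
    {c : ℝ} (h : Tendsto (fun i => dist P (S i)) atTop (𝓝 0))
    (hd : ∀ i, dist P' (S' i) ≤ c * dist P (S i)) :
    Tendsto (fun i => dist P' (S' i)) atTop (𝓝 0) :=
  squeeze_zero (fun _ => dist_nonneg _ _) hd (by simpa using h.const_mul c)

theorem IsSeqConst.of_comparable {H : X.RatPt → ℝ} {H' : Y.RatPt → ℝ} {P : X.RatPt}
    {P' : Y.RatPt} {S : ℕ → X.RatPt} {S' : ℕ → Y.RatPt} {α c C : ℝ} (h : IsSeqConst H P S α)
    (hc : 0 ≤ c) (hC : 0 ≤ C) (hpos : ∀ x, 0 ≤ H x) (hpos' : ∀ x, 0 ≤ H' x)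
    (hne : ∀ i, S' i ≠ P')
    (hd : ∀ i, dist P' (S' i) ≤ c * dist P (S i)) (hd' : ∀ i, dist P (S i) ≤ c * dist P' (S' i))
    (hH : ∀ i, H' (S' i) ≤ C * H (S i)) (hH' : ∀ i, H (S i) ≤ C * H' (S' i)) :
    IsSeqConst H' P' S' α := by
  refine ⟨⟨hne, tendsto_dist_of_le h.1.2 hd⟩, ?_⟩
  have : {a : ℝ | 0 ≤ a ∧ FiniteLimsup H' P' S' a} = {a : ℝ | 0 ≤ a ∧ FiniteLimsup H P S a} :=
    Set.ext fun a => and_congr_right fun ha =>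
      ⟨fun h => h.of_comparable ha hc hC hpos hd' (Eventually.of_forall hH'),
        fun h => h.of_comparable ha hc hC hpos' hd (Eventually.of_forall hH)⟩
  rw [this]
  exact h.2

theorem FiniteLimsup.comp {H : X.RatPt → ℝ} {P : X.RatPt} {S : ℕ → X.RatPt} {a : ℝ}
    (h : FiniteLimsup H P S a) {φ : ℕ → ℕ} (hφ : StrictMono φ) :
    FiniteLimsup H P (fun i => S (φ i)) a := by
  obtain ⟨M, hM⟩ := h
  exact ⟨M, eventually_map.2 (hφ.tendsto_atTop.eventually (eventually_map.1 hM))⟩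

/-- A sequence converging for `dist` eventually enters every Zariski neighbourhood of its limit. -/
theorem BoundedBelowNear.exists_eventually {H : X.RatPt → ℝ} {P : X.RatPt}
    (h : BoundedBelowNear H P) {S : ℕ → X.RatPt}
    (hS : Tendsto (fun i => dist P (S i)) atTop (𝓝 0)) :
    ∃ c : ℝ, 0 < c ∧ ∀ᶠ i in atTop, c < H (S i) := by
  obtain ⟨U, hU, hPU, c, hc, hlt⟩ := h
  obtain ⟨ε, hε, hsub⟩ := hU.exists_dist_lt hPU
  refine ⟨c, hc, ?_⟩
  filter_upwards [hS.eventually_lt_const hε] with i hi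
  exact hlt _ (hsub _ hi)

/-- Otherwise the values are bounded along a subsequence, which again approximates `P` and has an
admissible exponent below `α`. -/
theorem IsPointConst.tendsto_atTop {H : X.RatPt → ℝ} {P : X.RatPt} {α a : ℝ}
    (h : IsPointConst H P α) {S : ℕ → X.RatPt} (hS : Approximates S P) (ha : 0 ≤ a) (haα : a < α) :
    Tendsto (fun i => dist P (S i) ^ a * H (S i)) atTop atTop := by
  rw [Filter.tendsto_atTop]
  by_contra! hM
  obtain ⟨M, hM⟩ := hM
  obtain ⟨φ, hφ, hlt⟩ := extraction_of_frequently_atTop hM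
  refine haα.not_ge (h.2 (fun i => S (φ i))
    ⟨fun i => hS.1 _, hS.2.comp hφ.tendsto_atTop⟩ a ha ⟨M, eventually_map.2 ?_⟩)
  exact Eventually.of_forall fun i => (hlt i).le

theorem IsPointConst.nonneg {H : X.RatPt → ℝ} {P : X.RatPt} {α : ℝ} (h : IsPointConst H P α) :
    0 ≤ α := by
  obtain ⟨S, hS⟩ := h.1
  exact hS.2.1.1

/-- For `α > 0` the expression even diverges; for `α = 0` the distance has exponent zero and the
local lower bound of the height remains. -/
theorem IsPointConst.exists_eventually_le {H : X.RatPt → ℝ} {P : X.RatPt} {α θ : ℝ}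
    (h : IsPointConst H P α) (hP : BoundedBelowNear H P) {S : ℕ → X.RatPt}
    (hS : Approximates S P) (hθ : 0 ≤ θ) (hθ1 : θ < 1) :
    ∃ c : ℝ, 0 < c ∧ ∀ᶠ i in atTop, c ≤ dist P (S i) ^ (θ * α) * H (S i) := by
  rcases h.nonneg.eq_or_lt with h0 | h0
  · obtain ⟨c, hc, hlt⟩ := hP.exists_eventually hS.2
    refine ⟨c, hc, ?_⟩
    filter_upwards [hlt] with i hi
    simpa [← h0] using hi.le
  · exact ⟨1, one_pos, (h.tendsto_atTop hS (by positivity)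
      (mul_lt_of_lt_one_left h0 hθ1)).eventually_ge_atTop 1⟩

theorem not_tendsto_atTop_of_mul_le {f g : ℕ → ℝ} {c M : ℝ} (hc : 0 < c)
    (hg : ∀ᶠ i in atTop, c ≤ g i) (hfg : ∀ᶠ i in atTop, f i * g i ≤ M) :
    ¬ Tendsto f atTop atTop := by
  intro hf
  obtain ⟨i, h1, h2, h3, h4⟩ := (hg.and (hfg.and ((hf.eventually_gt_atTop 0).and
    (hf.eventually_gt_atTop (M / c))))).exists
  rw [div_lt_iff₀ hc] at h4
  nlinarith

/-! ### Approximation on products -/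

section Product

variable {P : X.RatPt} {Q : Y.RatPt} {HX : X.RatPt → ℝ} {HY : Y.RatPt → ℝ}
  {HL : (X.prod Y).RatPt → ℝ} {C α β : ℝ}

theorem IsSeqConst.pair_left {S : ℕ → X.RatPt} (hS : IsSeqConst HX P S α) (hC : 0 < C)
    (hX : ∀ x, 0 < HX x) (hY : ∀ y, 0 < HY y) (hL : ∀ z, 0 < HL z)
    (hle : ∀ z, HX z.fst * HY z.snd ≤ C * HL z) (hge : ∀ z, HL z ≤ C * (HX z.fst * HY z.snd)) :
    IsSeqConst HL (P.pair Q) (fun i => (S i).pair Q) α := by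
  have hQ := hY Q
  refine hS.of_comparable (c := 4) (C := max (C * HY Q) (C / HY Q)) (by norm_num)
    (by positivity) (fun x => (hX x).le) (fun z => (hL z).le)
    (fun i h => hS.1.1 i (RatPt.pair_eq_pair_iff.1 h).1) (fun i => ?_)
    (fun i => dist_left_le _ _ _ _) (fun i => ?_) (fun i => ?_)
  · have := dist_pair_le P (S i) Q Q
    rw [dist_self, add_zero] at this
    linarith [dist_nonneg P (S i)]
  · calc HL ((S i).pair Q) ≤ C * (HX (S i) * HY Q) := hge _
      _ = (C * HY Q) * HX (S i) := by ring
      _ ≤ _ := mul_le_mul_of_nonneg_right (le_max_left _ _) (hX _).le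
  · calc HX (S i) = (HX (S i) * HY Q) / HY Q := by field_simp
      _ ≤ (C * HL ((S i).pair Q)) / HY Q :=
        div_le_div_of_nonneg_right (hle ((S i).pair Q)) (by positivity)
      _ = C / HY Q * HL ((S i).pair Q) := by ring
      _ ≤ _ := mul_le_mul_of_nonneg_right (le_max_right _ _) (hL _).le

theorem IsSeqConst.pair_right {T : ℕ → Y.RatPt} (hT : IsSeqConst HY Q T β) (hC : 0 < C)
    (hX : ∀ x, 0 < HX x) (hY : ∀ y, 0 < HY y) (hL : ∀ z, 0 < HL z)
    (hle : ∀ z, HX z.fst * HY z.snd ≤ C * HL z) (hge : ∀ z, HL z ≤ C * (HX z.fst * HY z.snd)) :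
    IsSeqConst HL (P.pair Q) (fun i => P.pair (T i)) β := by
  have hP := hX P
  refine hT.of_comparable (c := 4) (C := max (C * HX P) (C / HX P)) (by norm_num)
    (by positivity) (fun x => (hY x).le) (fun z => (hL z).le)
    (fun i h => hT.1.1 i (RatPt.pair_eq_pair_iff.1 h).2) (fun i => ?_)
    (fun i => dist_right_le _ _ _ _) (fun i => ?_) (fun i => ?_)
  · have := dist_pair_le P P Q (T i)
    rw [dist_self, zero_add] at this
    linarith [dist_nonneg Q (T i)]
  · calc HL (P.pair (T i)) ≤ C * (HX P * HY (T i)) := hge _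
      _ = (C * HX P) * HY (T i) := by ring
      _ ≤ _ := mul_le_mul_of_nonneg_right (le_max_left _ _) (hY _).le
  · calc HY (T i) = (HX P * HY (T i)) / HX P := by field_simp
      _ ≤ (C * HL (P.pair (T i))) / HX P :=
        div_le_div_of_nonneg_right (hle (P.pair (T i))) (by positivity)
      _ = C / HX P * HL (P.pair (T i)) := by ring
      _ ≤ _ := mul_le_mul_of_nonneg_right (le_max_right _ _) (hL _).le

/-- The exponent of a sequence on a product is at least one of the approximation constants of
the factors. -/
theorem FiniteLimsup.le_or_le (hα : IsPointConst HX P α) (hβ : IsPointConst HY Q β)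
    (hP : BoundedBelowNear HX P) (hQ : BoundedBelowNear HY Q) (hC : 0 < C)
    (hX : ∀ x, 0 < HX x) (hY : ∀ y, 0 < HY y)
    (hle : ∀ z, HX z.fst * HY z.snd ≤ C * HL z)
    {S : ℕ → (X.prod Y).RatPt} (hS : Approximates S (P.pair Q)) {a : ℝ} (ha : 0 ≤ a)
    (h : FiniteLimsup HL (P.pair Q) S a) : α ≤ a ∨ β ≤ a := by
  have hdX (i : ℕ) : dist P (S i).fst ≤ 4 * dist (P.pair Q) (S i) := dist_left_le _ _ Q (S i).snd
  have hdY (i : ℕ) : dist Q (S i).snd ≤ 4 * dist (P.pair Q) (S i) := dist_right_le P (S i).fst _ _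
  have htX := tendsto_dist_of_le (S' := fun i => (S i).fst) hS.2 hdX
  have htY := tendsto_dist_of_le (S' := fun i => (S i).snd) hS.2 hdY
  have hfreq : ∃ᶠ i in atTop, (S i).fst ≠ P ∨ (S i).snd ≠ Q :=
    Eventually.frequently (Eventually.of_forall fun i => by
      by_contra! hi
      exact hS.1 i (RatPt.pair_eq_pair_iff (x := (S i).fst) (y := (S i).snd).2 hi))
  -- Neither component need avoid its limit eventually, but one of them does so along a subsequence.
  rcases frequently_or_distrib.1 hfreq with hf | hf
  · left
    obtain ⟨φ, hφ, hne⟩ := extraction_of_frequently_atTop hf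
    -- The second components may equal `Q`; only their convergence is needed to bound their heights
    -- below.
    obtain ⟨c, hc, hlt⟩ := hQ.exists_eventually htY
    refine hα.2 (fun i => (S (φ i)).fst) ⟨hne, htX.comp hφ.tendsto_atTop⟩ a ha ?_
    refine (h.comp hφ).of_comparable (c := 4) (C := C / c) ha (by norm_num) (by positivity)
      (fun x => (hX x).le) (fun i => hdX _) ?_
    filter_upwards [hφ.tendsto_atTop.eventually hlt] with i hi
    rw [div_mul_eq_mul_div, le_div_iff₀ hc]
    exact (mul_le_mul_of_nonneg_left hi.le (hX _).le).trans (hle _)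
  · right
    obtain ⟨φ, hφ, hne⟩ := extraction_of_frequently_atTop hf
    obtain ⟨c, hc, hlt⟩ := hP.exists_eventually htX
    refine hβ.2 (fun i => (S (φ i)).snd) ⟨hne, htY.comp hφ.tendsto_atTop⟩ a ha ?_
    refine (h.comp hφ).of_comparable (c := 4) (C := C / c) ha (by norm_num) (by positivity)
      (fun x => (hY x).le) (fun i => hdY _) ?_
    filter_upwards [hφ.tendsto_atTop.eventually hlt] with i hi
    rw [div_mul_eq_mul_div, le_div_iff₀ hc, mul_comm]
    exact (mul_le_mul_of_nonneg_right hi.le (hY _).le).trans (hle _)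

/-- A sequence on a product both of whose components avoid the given points satisfies the limsup
condition for no exponent below the sum of the approximation constants. -/
theorem FiniteLimsup.add_le (hα : IsPointConst HX P α) (hβ : IsPointConst HY Q β)
    (hP : BoundedBelowNear HX P) (hQ : BoundedBelowNear HY Q) (hC : 0 < C)
    (hX : ∀ x, 0 < HX x) (hY : ∀ y, 0 < HY y) (hle : ∀ z, HX z.fst * HY z.snd ≤ C * HL z)
    {S : ℕ → X.RatPt} {T : ℕ → Y.RatPt} (hS : Approximates S P) (hT : Approximates T Q)
    {γ : ℝ} (hγ : 0 ≤ γ) (h : FiniteLimsup HL (P.pair Q) (fun i => (S i).pair (T i)) γ) :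
    α + β ≤ γ := by
  by_contra! hlt
  have hα0 := hα.nonneg
  have hβ0 := hβ.nonneg
  have hsum : 0 < α + β := hγ.trans_lt hlt
  -- Splitting `γ` in the ratio `α : β` puts each part strictly below its approximation constant
  -- whenever that constant is positive.
  set θ := γ / (α + β) with hθ
  have hθ0 : 0 ≤ θ := by positivity
  have hθ1 : θ < 1 := (div_lt_one hsum).2 hlt
  have hγθ : γ = θ * α + θ * β := by rw [hθ]; field_simp
  obtain ⟨c, hc, hcS⟩ := hα.exists_eventually_le hP hS hθ0 hθ1
  obtain ⟨d, hd, hdT⟩ := hβ.exists_eventually_le hQ hT hθ0 hθ1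
  obtain ⟨M, hM⟩ := h
  have hprod : ∀ᶠ i in atTop, (dist P (S i) ^ (θ * α) * HX (S i)) *
      (dist Q (T i) ^ (θ * β) * HY (T i)) ≤ 4 ^ γ * C * M := by
    filter_upwards [eventually_map.1 hM] with i hi
    set D := dist (P.pair Q) ((S i).pair (T i))
    have hD : 0 ≤ D := dist_nonneg _ _
    have h1 : dist P (S i) ^ (θ * α) ≤ (4 * D) ^ (θ * α) :=
      Real.rpow_le_rpow (dist_nonneg _ _) (dist_left_le _ _ _ _) (by positivity)
    have h2 : dist Q (T i) ^ (θ * β) ≤ (4 * D) ^ (θ * β) :=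
      Real.rpow_le_rpow (dist_nonneg _ _) (dist_right_le _ _ _ _) (by positivity)
    have h3 : HX (S i) * HY (T i) ≤ C * HL ((S i).pair (T i)) := hle ((S i).pair (T i))
    calc _ = (dist P (S i) ^ (θ * α) * dist Q (T i) ^ (θ * β)) * (HX (S i) * HY (T i)) := by ring
      _ ≤ ((4 * D) ^ (θ * α) * (4 * D) ^ (θ * β)) * (C * HL ((S i).pair (T i))) := by
        have hx := hX (S i)
        have hy := hY (T i)
        refine mul_le_mul (mul_le_mul h1 h2 (Real.rpow_nonneg (dist_nonneg _ _) _)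
          (by positivity)) h3 (by positivity) (by positivity)
      _ = 4 ^ γ * C * (D ^ γ * HL ((S i).pair (T i))) := by
        rw [← Real.rpow_add_of_nonneg (by positivity) (by positivity) (by positivity), ← hγθ,
          Real.mul_rpow (by norm_num) hD]
        ring
      _ ≤ 4 ^ γ * C * M := by gcongr
  -- Since `α + β > 0`, one factor of the bounded product diverges while the other stays bounded
  -- below.
  rcases hα0.eq_or_lt with h0 | h0
  · have hβpos : 0 < β := by linarith
    refine not_tendsto_atTop_of_mul_le (M := 4 ^ γ * C * M) hc hcS ?_ (hβ.tendsto_atTop hT (by positivity)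
      (mul_lt_of_lt_one_left hβpos hθ1))
    filter_upwards [hprod] with i hi
    rwa [mul_comm]
  · exact not_tendsto_atTop_of_mul_le hd hdT hprod (hα.tendsto_atTop hS (by positivity)
      (mul_lt_of_lt_one_left h0 hθ1))

end Product

end ProjVariety

/-! ### The theorem on products -/

theorem theorem3p1 {k : Type u} [Field k] [NumberField k] (X Y : ProjVariety k)
    (P : X.RatPt) (Q : Y.RatPt) (LX : X.LineBundle) (LY : Y.LineBundle)
    (HX : X.RatPt → ℝ) (HY : Y.RatPt → ℝ)
    (hHX : ProjVariety.IsWeilHeight LX HX) (hHY : ProjVariety.IsWeilHeight LY HY)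
    (hP : ProjVariety.BoundedBelowNear HX P) (hQ : ProjVariety.BoundedBelowNear HY Q)
    (Pseq : ℕ → X.RatPt) (Qseq : ℕ → Y.RatPt) (α β : ℝ)
    (hα : ProjVariety.IsPointConst HX P α) (hPseq : ProjVariety.IsSeqConst HX P Pseq α)
    (hβ : ProjVariety.IsPointConst HY Q β) (hQseq : ProjVariety.IsSeqConst HY Q Qseq β)
    (HL : (X.prod Y).RatPt → ℝ)
    (hHL : ProjVariety.IsWeilHeight
      ((LX.pullback (ProjVariety.fst X Y)).tensor (LY.pullback (ProjVariety.snd X Y))) HL) :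
    ProjVariety.BoundedBelowNear HL (P.pair Q) ∧
    (ProjVariety.IsBestSeq HL (P.pair Q) (fun i => (Pseq i).pair Q) ∨
      ProjVariety.IsBestSeq HL (P.pair Q) (fun i => P.pair (Qseq i))) ∧
    ∀ (S : ℕ → X.RatPt) (T : ℕ → Y.RatPt) (γ : ℝ),
      ProjVariety.IsSeqConst HL (P.pair Q) (fun i => (S i).pair (T i)) γ → γ < α + β →
        ∀ᶠ i in atTop, S i = P ∨ T i = Q := by
  obtain ⟨C₁, hC₁, hle₁⟩ := hHL.exists_le (hHX.prod hHY)
  obtain ⟨C₂, hC₂, hge₂⟩ := (hHX.prod hHY).exists_le hHL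
  have hX := hHX.pos
  have hY := hHY.pos
  have hL := hHL.pos
  have hC : 0 < max C₁ C₂ := lt_max_of_lt_left hC₁
  have hle (z : (X.prod Y).RatPt) : HX z.fst * HY z.snd ≤ max C₁ C₂ * HL z :=
    (hle₁ z).trans (mul_le_mul_of_nonneg_right (le_max_left _ _) (hL z).le)
  have hge (z : (X.prod Y).RatPt) : HL z ≤ max C₁ C₂ * (HX z.fst * HY z.snd) :=
    (hge₂ z).trans (mul_le_mul_of_nonneg_right (le_max_right _ _)
      (mul_pos (hX _) (hY _)).le)
  have hPs := hPseq.pair_left (Q := Q) hC hX hY hL hle hge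
  have hQs := hQseq.pair_right (P := P) hC hX hY hL hle hge
  refine ⟨hP.prod hQ hC hle, ?_, fun S T γ hST hγ => ?_⟩
  -- The approximation constant of `(P, Q)` is the smaller of `α` and `β`.
  · rcases le_total α β with hαβ | hαβ
    · refine Or.inl ⟨α, ⟨⟨_, hPs⟩, fun S hS a ha h => ?_⟩, hPs⟩
      rcases h.le_or_le hα hβ hP hQ hC hX hY hle hS ha with h | h
      exacts [h, hαβ.trans h]
    · refine Or.inr ⟨β, ⟨⟨_, hQs⟩, fun S hS a ha h => ?_⟩, hQs⟩
      rcases h.le_or_le hα hβ hP hQ hC hX hY hle hS ha with h | h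
      exacts [hαβ.trans h, h]
  · by_contra hfreq
    rw [not_eventually] at hfreq
    obtain ⟨φ, hφ, hne⟩ := extraction_of_frequently_atTop hfreq
    simp only [not_or] at hne
    have ht := hST.1.2.comp hφ.tendsto_atTop
    refine hγ.not_ge (ProjVariety.FiniteLimsup.add_le hα hβ hP hQ hC hX hY hle
      (S := fun i => S (φ i)) (T := fun i => T (φ i))
      ⟨fun i => (hne i).1, ProjVariety.tendsto_dist_of_le ht fun i =>
        ProjVariety.dist_left_le _ _ _ _⟩
      ⟨fun i => (hne i).2, ProjVariety.tendsto_dist_of_le ht fun i =>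
        ProjVariety.dist_right_le _ _ _ _⟩ hST.2.1.1 ?_)
    exact hST.2.1.2.comp hφ
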